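/- Let $\Gamma$ be a non-elementary (i.e. not virtually cyclic) hyperbolic group, and let $S$ and $S_*$ be two finite generating sets of $\Gamma$. For $g\in\Gamma$ let $|g|_S$ be the word length of $g$ with respect to $S\cup S^{-1}$, and let $\ell_S[g]=\lim_{n\to\infty}|g^n|_S/n$ be the stable translation length, which depends only on the conjugacy class $[g]$; define $\ell_{S_*}$ in the same way from $S_*$. Put $$\mathrm{Dil}(S_*,S)=\sup_{g}\frac{\ell_{S_*}[g]}{\ell_S[g]},\qquad \mathrm{Dil}(S,S_*)=\sup_{g}\frac{\ell_{S}[g]}{\ell_{S_*}[g]},$$ where $g$ ranges over the elements of infinite order of $\Gamma$, so that $\mathrm{Dil}(S,S_*)^{-1}=\inf_g \ell_{S_*}[g]/\ell_S[g]$. Then there is a constant $C>0$ such that for every $\eta\in[\mathrm{Dil}(S,S_*)^{-1},\mathrm{Dil}(S_*,S)]$ there is an infinite sequence $(g_n)_{n\ge1}$ of pairwise distinct elements of $\Gamma$ with $\ell_S[g_n]>0$ and $$\left|\frac{\ell_{S_*}[g_n]}{\ell_S[g_n]}-\eta\right|\le\frac{C}{|g_n|_S^{2}}\qquad\text{for all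 } n\ge 1.$$ Moreover, if $\eta\in[\mathrm{Dil}(S,S_*)^{-1},\mathrm{Dil}(S_*,S)]$ is rational, then there is $g\in\Gamma$ with $\ell_S[g]>0$ and $$\frac{\ell_{S_*}[g]}{\ell_S[g]}=\eta .$$ -/

import Mathlib

open Filter Topology

namespace WordMetric

variable {Γ : Type*} [Group Γ]

/-- `Represents S g l`: the list `l` is a word in the letters `S ∪ S⁻¹` whose product is `g`. -/
def Represents (S : Set Γ) (g : Γ) (l : List Γ) : Prop :=
  (∀ x ∈ l, x ∈ S ∨ x⁻¹ ∈ S) ∧ l.prod = g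

/-- The word length `|g|_S`: the least length of a word in `S ∪ S⁻¹` representing `g`.
It is only used for generating sets `S`, for which such a word exists. -/
noncomputable def wordLength (S : Set Γ) (g : Γ) : ℕ :=
  sInf {n : ℕ | ∃ l : List Γ, Represents S g l ∧ l.length = n}

/-- The (left-invariant) word metric `d_S(x, y) = |x⁻¹ y|_S`. -/
noncomputable def wordDist (S : Set Γ) (x y : Γ) : ℕ :=
  wordLength S (x⁻¹ * y)

/-- The stable translation length `ℓ_S[g] = lim_n d_S(gⁿ, 1) / n` of the word metric `d_S`.
The limit exists, see `tendsto_translationLength`, and depends only on the conjugacy class of `g`,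
see `translationLength_conj`. -/
noncomputable def translationLength (S : Set Γ) (g : Γ) : ℝ :=
  limUnder atTop (fun n : ℕ => (wordDist S (g ^ n) 1 : ℝ) / (n : ℝ))

/-- The dilation `Dil(S, T)`: the supremum of `ℓ_S[g] / ℓ_T[g]` over the non-torsion `g`. -/
noncomputable def dilation (S T : Set Γ) : ℝ :=
  sSup {r : ℝ | ∃ g : Γ, ¬ IsOfFinOrder g ∧ r = translationLength S g / translationLength T g}

/-- Gromov's four-point condition for the word metric `d_S`. -/
def FourPoint (S : Set Γ) (δ : ℝ) : Prop :=
  ∀ x y z w : Γ, (wordDist S x y : ℝ) + wordDist S z w ≤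
    max ((wordDist S x z : ℝ) + wordDist S y w) ((wordDist S x w : ℝ) + wordDist S y z) + δ

variable (Γ) in
/-- A (word-)hyperbolic group: one with a finite generating set whose word metric is
Gromov hyperbolic. -/
def IsHyperbolicGroup : Prop :=
  ∃ S : Set Γ, S.Finite ∧ Subgroup.closure S = ⊤ ∧ ∃ δ : ℝ, FourPoint S δ

variable (Γ) in
/-- A group is non-elementary if it is not virtually cyclic (in particular it is infinite). -/
def IsNonElementary : Prop :=
  ¬ ∃ H : Subgroup Γ, IsCyclic H ∧ H.FiniteIndex

theorem exists_represents {S : Set Γ} (hS : Subgroup.closure S = ⊤) (g : Γ) :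
    ∃ l : List Γ, Represents S g l ∧ l.length = wordLength S g := by
  have hne : {n : ℕ | ∃ l : List Γ, Represents S g l ∧ l.length = n}.Nonempty := by
    have hg : g ∈ Subgroup.closure S := by rw [hS]; trivial
    rw [← Subgroup.mem_toSubmonoid, Subgroup.closure_toSubmonoid] at hg
    obtain ⟨l, hl, hp⟩ := Submonoid.exists_list_of_mem_closure hg
    exact ⟨l.length, l, ⟨fun x hx => hl x hx, hp⟩, rfl⟩
  exact Nat.sInf_mem hne

theorem wordLength_le {S : Set Γ} {g : Γ} {l : List Γ} (h : Represents S g l) :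
    wordLength S g ≤ l.length :=
  Nat.sInf_le ⟨l, h, rfl⟩

theorem wordLength_mul_le {S : Set Γ} (hS : Subgroup.closure S = ⊤) (g h : Γ) :
    wordLength S (g * h) ≤ wordLength S g + wordLength S h := by
  obtain ⟨l, hl, hl'⟩ := exists_represents hS g
  obtain ⟨m, hm, hm'⟩ := exists_represents hS h
  have : Represents S (g * h) (l ++ m) := by
    refine ⟨fun x hx => ?_, by rw [List.prod_append, hl.2, hm.2]⟩
    rcases List.mem_append.1 hx with hx | hx
    · exact hl.1 x hx
    · exact hm.1 x hx
  have := wordLength_le this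
  rw [List.length_append] at this
  omega

theorem subadditive_wordDist_pow {S : Set Γ} (hS : Subgroup.closure S = ⊤) (g : Γ) :
    Subadditive (fun n : ℕ => (wordDist S (g ^ n) 1 : ℝ)) := by
  intro m n
  have h := wordLength_mul_le hS ((g ^ n)⁻¹) ((g ^ m)⁻¹)
  rw [← mul_inv_rev, ← pow_add, add_comm (wordLength S _)] at h
  simp only [wordDist, mul_one]
  exact_mod_cast h

/-- For a generating set the limit that defines the stable translation length exists. -/
theorem tendsto_translationLength {S : Set Γ} (hS : Subgroup.closure S = ⊤) (g : Γ) :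
    Tendsto (fun n : ℕ => (wordDist S (g ^ n) 1 : ℝ) / (n : ℝ)) atTop
      (𝓝 (translationLength S g)) := by
  have h := (subadditive_wordDist_pow hS g).tendsto_lim
    ⟨0, by rintro _ ⟨n, rfl⟩; positivity⟩
  exact tendsto_nhds_limUnder ⟨_, h⟩

theorem translationLength_conj_le {S : Set Γ} (hS : Subgroup.closure S = ⊤) (g h : Γ) :
    translationLength S (h * g * h⁻¹) ≤ translationLength S g := by
  have h1 := tendsto_translationLength hS (h * g * h⁻¹)
  have h2 : Tendsto (fun n : ℕ => (wordDist S (g ^ n) 1 : ℝ) / (n : ℝ) +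
      ((wordLength S h : ℝ) + wordLength S h⁻¹) / (n : ℝ)) atTop
      (𝓝 (translationLength S g + 0)) :=
    (tendsto_translationLength hS g).add (tendsto_const_div_atTop_nhds_zero_nat _)
  rw [add_zero] at h2
  refine le_of_tendsto_of_tendsto' h1 h2 fun n => ?_
  rw [← add_div]
  refine div_le_div_of_nonneg_right ?_ (Nat.cast_nonneg n)
  have h3 := wordLength_mul_le hS (h * (g ^ n)⁻¹) h⁻¹
  have h4 := wordLength_mul_le hS h ((g ^ n)⁻¹)
  have h5 : ((h * g * h⁻¹) ^ n)⁻¹ = h * (g ^ n)⁻¹ * h⁻¹ := by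
    rw [conj_pow]; group
  simp only [wordDist, mul_one, h5]
  have h6 : wordLength S (h * (g ^ n)⁻¹ * h⁻¹) ≤
      wordLength S (g ^ n)⁻¹ + (wordLength S h + wordLength S h⁻¹) := by omega
  exact_mod_cast h6

/-- The stable translation length is a function of the conjugacy class. -/
theorem translationLength_conj {S : Set Γ} (hS : Subgroup.closure S = ⊤) (g h : Γ) :
    translationLength S (h * g * h⁻¹) = translationLength S g := by
  refine le_antisymm (translationLength_conj_le hS g h) ?_
  have := translationLength_conj_le hS (h * g * h⁻¹) h⁻¹
  have e : h⁻¹ * (h * g * h⁻¹) * h⁻¹⁻¹ = g := by group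
  rwa [e] at this

end WordMetric

/-!
Both parts of the theorem come from producing group elements `g` whose pair of stable lengths
`(ℓ_S[g], ℓ_T[g])` is prescribed up to a bounded integral factor, with `|g|_S` controlled
linearly. The word metric of the generating set `S₀` with the four-point condition is used as a
background metric; geodesics for `S` and `T` are quasi-geodesics for it, and the geometric
input is stability of quasi-geodesics (`gromovProd_quasiGeodesic_le`, `exists_near_quasiGeodesic`)
and a local-to-global principle for Gromov products (`gromovProd_word_word_le`).

*Local types.* If some geodesic from `1` to `u v` passes near `u`, then `|u v|_S - |u|_S`
depends only on `v` and on the function `b ↦ |u b|_S - |u|_S` on a fixed ball, which takes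
finitely many values as `u` varies (`wordLength_sub_eq_of_localType_eq`,
`finite_range_localType`). The same holds for `T`.

*The dilations are attained* (`exists_forall_translationLength_mul_le`). By Cannon's argument the
`S`- and `T`-types of `g` together determine the `S`-cone of `g` and the growth of `T`-length
along it. A geodesic word `w` joining two points with the same data can therefore be repeated for
ever, so that `ℓ_S[w] = |w|_S` and `ℓ_T[w]` is the growth of `T`-length along `w`. Every long
`S`-geodesic decomposes into such loops of bounded length, up to a bounded remainder, and there
are finitely many of them. Hence the supremum of `ℓ_T / ℓ_S` is a maximum. Applied in both
directions this gives elements `a` and `b` whose ratios are the two ends of the interval.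

*Pumping* (`IsGuided.exists_wordLength_pump`, `translationLength_pump`). If the ratios of `a` and
`b` differ, no nontrivial powers of them agree, and large powers `A` and `B` generate a semigroup
in which all words are quasi-geodesic. In it the type of `u A` is a function of the type of `u`,
so the type of `u A ^ i` is eventually periodic in `i`. Consequently
`ℓ[u A ^ (i + N) v] = ℓ[u A ^ i v] + N ℓ[A]` exactly, for large `i` and a fixed period `N`, for both `S` and `T`; in particular
`N ℓ` is integral on the semigroup.

*Arithmetic* (`exists_nat_combination`, `exists_translationLength_ratio_eq`). The lengths of
`A ^ (M + s N) * B ^ (M + t N) * (A ^ M * B ^ M) ^ k` are affine in `(k, s, t)`, and Cramer's rule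
gives, for every rational `p / q` strictly between the ratios of `a` and `b`, an element with
ratio exactly `p / q`, of length `O(q)` once `q` is large. Dirichlet's approximation theorem then
settles irrational `η`; for the other `η` powers of a single element do.
-/

namespace WordMetric

variable {Γ : Type*} [Group Γ]

/-! ### Gromov products and quasi-geodesics in a hyperbolic space -/

section Geometry

variable {X : Type*}

/-- The Gromov product `(x | y)_p` of a distance function `d`. -/
noncomputable def gromovProd (d : X → X → ℝ) (p x y : X) : ℝ :=
  (d x p + d y p - d x y) / 2

/-- A pseudo-distance satisfying Gromov's inequality `(x | z)_p ≥ min ((x | y)_p) ((y | z)_p) - δ`.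
The normalisation `1 ≤ δ` costs nothing and lets `δ` absorb additive constants. -/
structure IsHyperbolicDist (d : X → X → ℝ) (δ : ℝ) : Prop where
  one_le : 1 ≤ δ
  self : ∀ x, d x x = 0
  symm : ∀ x y, d x y = d y x
  triangle : ∀ x y z, d x z ≤ d x y + d y z
  gromov : ∀ p x y z,
    min (gromovProd d p x y) (gromovProd d p y z) - δ ≤ gromovProd d p x z

/-- The points `q 0, …, q n` form a discrete quasi-geodesic with multiplicative constant `c` and
no additive constant. -/
def QuasiGeodesic (d : X → X → ℝ) (c : ℝ) (n : ℕ) (q : ℕ → X) : Prop :=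
  ∀ i j, i ≤ j → j ≤ n →
    ((j : ℝ) - i) ≤ c * d (q i) (q j) ∧ d (q i) (q j) ≤ c * ((j : ℝ) - i)

variable {d : X → X → ℝ} {δ : ℝ}

theorem IsHyperbolicDist.nonneg (h : IsHyperbolicDist d δ) (x y : X) : 0 ≤ d x y := by
  have h1 := h.triangle x y x
  rw [h.self, h.symm y x] at h1
  linarith

theorem IsHyperbolicDist.gromovProd_comm (h : IsHyperbolicDist d δ) (p x y : X) :
    gromovProd d p x y = gromovProd d p y x := by
  simp only [gromovProd, h.symm x y]; ring

theorem IsHyperbolicDist.gromovProd_self (h : IsHyperbolicDist d δ) (p x : X) :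
    gromovProd d p x x = d x p := by
  simp only [gromovProd, h.self]; ring

theorem IsHyperbolicDist.gromovProd_le_add (h : IsHyperbolicDist d δ) (p x y y' : X) :
    gromovProd d p x y' ≤ gromovProd d p x y + d y y' := by
  have h1 := h.triangle y' y p
  have h2 := h.triangle x y' y
  rw [h.symm y' y] at h1 h2
  simp only [gromovProd]
  linarith

/-- If `(x | y)_p` is small while `(y | z)_p` is not, then `(x | z)_p` is small. -/
theorem IsHyperbolicDist.gromovProd_le (h : IsHyperbolicDist d δ) {p x y z : X} {K : ℝ}
    (h1 : gromovProd d p x y ≤ K) (h2 : K + δ < gromovProd d p y z) :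
    gromovProd d p x z ≤ K + δ := by
  have h3 := h.gromov p x z y
  rw [h.gromovProd_comm p z y] at h3
  rcases min_choice (gromovProd d p x z) (gromovProd d p y z) with h4 | h4 <;>
    rw [h4] at h3 <;> linarith

/-- A chain of at most `2 ^ k` steps loses at most `k δ` in Gromov's inequality. -/
theorem IsHyperbolicDist.gromovProd_chain (h : IsHyperbolicDist d δ) (p : X) (m : ℝ) :
    ∀ (k n : ℕ) (q : ℕ → X), 0 < n → n ≤ 2 ^ k →
      (∀ i < n, m ≤ gromovProd d p (q i) (q (i + 1))) →
      m - k * δ ≤ gromovProd d p (q 0) (q n) := by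
  intro k
  induction k with
  | zero =>
    intro n q hn hn' hq
    obtain rfl : n = 1 := by simp at hn'; omega
    simpa using hq 0 one_pos
  | succ k ih =>
    intro n q hn hn' hq
    have hδ := h.one_le
    push_cast
    by_cases hnk : n ≤ 2 ^ k
    · have := ih n q hn hnk hq
      linarith
    · have h1 := ih (2 ^ k) q (by positivity) le_rfl fun i hi => hq i (by omega)
      have h2 := ih (n - 2 ^ k) (fun i => q (2 ^ k + i)) (by omega) (by rw [pow_succ] at hn'; omega)
        fun i hi => hq (2 ^ k + i) (by omega)
      simp only [add_zero] at h2
      rw [show 2 ^ k + (n - 2 ^ k) = n by omega] at h2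
      have h3 := h.gromov p (q 0) (q (2 ^ k)) (q n)
      have h4 := le_min h1 h2
      linarith

theorem exists_affine_le_two_pow (a b : ℝ) : ∃ k₀ : ℕ, ∀ k : ℕ, k₀ ≤ k → a * k + b ≤ 2 ^ k := by
  obtain ⟨k₁, hk₁⟩ := exists_nat_ge (|a| + |b|)
  refine ⟨k₁ + 4, fun k hk => ?_⟩
  have h0 : ∀ m : ℕ, 4 ≤ m → m ^ 2 ≤ 2 ^ m := by
    intro m hm
    induction m, hm using Nat.le_induction with
    | base => norm_num
    | succ m hm ih => rw [pow_succ 2 m]; nlinarith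
  have h1 : (k : ℝ) ^ 2 ≤ 2 ^ k := by exact_mod_cast h0 k (by omega)
  have h2 : (k₁ : ℝ) + 4 ≤ k := by exact_mod_cast hk
  have h3 := le_abs_self a
  have h4 := le_abs_self b
  have h5 := abs_nonneg b
  have h6 := abs_nonneg a
  nlinarith

/-- In a chain of points at distance at least `D` from `p` with bounded steps, the Gromov product
of the end points is at least `D` up to a logarithmic error. -/
theorem IsHyperbolicDist.le_gromovProd_of_quasiGeodesic (h : IsHyperbolicDist d δ) {c : ℝ}
    (hc : 0 ≤ c) {n : ℕ} {q : ℕ → X} (hq : QuasiGeodesic d c n q) {p : X} {D : ℝ}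
    (hD : ∀ i ≤ n, D ≤ d p (q i)) (k i j : ℕ) (hi : i ≤ n) (hj : j ≤ n)
    (hij : |(j : ℝ) - i| ≤ 2 ^ k) :
    D - c - k * δ ≤ gromovProd d p (q i) (q j) := by
  have hkδ : 0 ≤ k * δ := mul_nonneg (Nat.cast_nonneg k) (by linarith [h.one_le])
  have key : ∀ i j, i ≤ j → j ≤ n → |(j : ℝ) - i| ≤ 2 ^ k →
      D - c - k * δ ≤ gromovProd d p (q i) (q j) := by
    intro i j hij' hj hij
    rcases hij'.eq_or_lt with rfl | hlt
    · rw [h.gromovProd_self, h.symm]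
      linarith [hD i hj]
    · have h1 : j - i ≤ 2 ^ k := by
        have h2 := le_trans (le_abs_self _) hij
        rw [← Nat.cast_sub hij'] at h2
        exact_mod_cast h2
      have h3 := h.gromovProd_chain p (D - c) k (j - i) (fun t => q (i + t)) (by omega) h1
        fun t ht => by
          have h4 := (hq (i + t) (i + (t + 1)) (by omega) (by omega)).2
          have h5 := hD (i + t) (by omega)
          have h6 := hD (i + (t + 1)) (by omega)
          push_cast at h4
          simp only [gromovProd]
          rw [h.symm _ p, h.symm _ p]
          have h7 : c * ((i : ℝ) + (t + 1) - (i + t)) = c := by ring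
          rw [h7] at h4
          linarith
      simpa [show i + (j - i) = j by omega] using h3
  rcases le_total i j with h1 | h1
  · exact key i j h1 hj hij
  · rw [h.gromovProd_comm]
    exact key j i h1 hi (by rwa [abs_sub_comm])

/-- A geodesic stays uniformly close to any quasi-geodesic with the same end points. -/
theorem IsHyperbolicDist.geodesic_near_quasiGeodesic (h : IsHyperbolicDist d δ) {c : ℝ}
    (hc : 1 ≤ c) : ∃ D₀ : ℝ, 0 ≤ D₀ ∧ ∀ (n m : ℕ) (q z : ℕ → X), QuasiGeodesic d c n q →
      (∀ i j, i ≤ j → j ≤ m → d (z i) (z j) = (j : ℝ) - i) → z 0 = q 0 → z m = q n →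
      ∀ t ≤ m, ∃ i ≤ n, d (z t) (q i) ≤ D₀ := by
  have hδ := h.one_le
  obtain ⟨k₀, hk₀⟩ := exists_affine_le_two_pow (6 * c * δ) (c * (6 * (4 * δ + c) + 2))
  refine ⟨(k₀ + 3) * δ + c, by positivity, fun n m q z hq hz hz0 hzm => ?_⟩
  have hmin : ∀ t, ∃ i ≤ n, ∀ j ≤ n, d (z t) (q i) ≤ d (z t) (q j) := by
    intro t
    obtain ⟨i, hi, hi'⟩ := Finset.exists_min_image (Finset.range (n + 1)) (fun i => d (z t) (q i))
      ⟨0, by simp⟩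
    exact ⟨i, by simpa [Nat.lt_succ_iff] using hi,
      fun j hj => hi' j (by simpa [Nat.lt_succ_iff] using hj)⟩
  choose f hf hf' using hmin
  obtain ⟨t₀, ht₀, hmax⟩ := Finset.exists_max_image (Finset.range (m + 1))
    (fun t => d (z t) (q (f t))) ⟨0, by simp⟩
  have ht₀' : t₀ ≤ m := by simpa [Nat.lt_succ_iff] using ht₀
  have hmax' : ∀ t ≤ m, d (z t) (q (f t)) ≤ d (z t₀) (q (f t₀)) :=
    fun t ht => hmax t (by simpa [Nat.lt_succ_iff] using ht)
  -- `D` is the largest distance from a point of the geodesic to the quasi-geodesic.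
  set D := d (z t₀) (q (f t₀)) with hD
  suffices hDle : D ≤ (k₀ + 3) * δ + c from
    fun t ht => ⟨f t, hf t, (hmax' t ht).trans hDle⟩
  by_contra hcon
  push Not at hcon
  have hDpos : 0 ≤ D := h.nonneg _ _
  set p := z t₀ with hp
  have hDq : ∀ i ≤ n, D ≤ d p (q i) := fun i hi => hf' t₀ i hi
  -- Two points of the geodesic on either side of `p`, at distance about `2 D` where possible.
  have hleft : ∃ t i, t ≤ t₀ ∧ i ≤ n ∧ D ≤ gromovProd d p (z t) (q i) ∧
      d (z t) (q i) ≤ D ∧ d (z t) p ≤ 2 * D + 1 := by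
    rcases le_or_gt t₀ ⌈2 * D⌉₊ with hle | hgt
    · refine ⟨0, 0, Nat.zero_le _, Nat.zero_le _, ?_, ?_, ?_⟩
      · rw [hz0, h.gromovProd_self, h.symm]; exact hDq 0 (Nat.zero_le _)
      · rw [hz0, h.self]; exact hDpos
      · rw [hz 0 t₀ (Nat.zero_le _) ht₀']
        have h1 : (t₀ : ℝ) ≤ ⌈2 * D⌉₊ := by exact_mod_cast hle
        have h2 := Nat.ceil_lt_add_one (show 0 ≤ 2 * D by positivity)
        simp; linarith
    · have h0 : d (z (t₀ - ⌈2 * D⌉₊)) p = ⌈2 * D⌉₊ := by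
        rw [hz _ t₀ (Nat.sub_le _ _) ht₀', Nat.cast_sub hgt.le]; ring
      have h1 := Nat.le_ceil (2 * D)
      have h2 := Nat.ceil_lt_add_one (show 0 ≤ 2 * D by positivity)
      have h3 := hmax' (t₀ - ⌈2 * D⌉₊) (by omega)
      refine ⟨t₀ - ⌈2 * D⌉₊, f (t₀ - ⌈2 * D⌉₊), Nat.sub_le _ _, hf _, ?_, h3, by linarith⟩
      have h4 := hDq _ (hf (t₀ - ⌈2 * D⌉₊))
      simp only [gromovProd]
      rw [h.symm (q _) p]; linarith
  have hright : ∃ t i, t₀ ≤ t ∧ t ≤ m ∧ i ≤ n ∧ D ≤ gromovProd d p (z t) (q i) ∧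
      d (z t) (q i) ≤ D ∧ d (z t) p ≤ 2 * D + 1 := by
    rcases le_or_gt m (t₀ + ⌈2 * D⌉₊) with hle | hgt
    · refine ⟨m, n, ht₀', le_rfl, le_rfl, ?_, ?_, ?_⟩
      · rw [hzm, h.gromovProd_self, h.symm]; exact hDq n le_rfl
      · rw [hzm, h.self]; exact hDpos
      · rw [h.symm, hz t₀ m ht₀' le_rfl]
        have h1 : (m : ℝ) ≤ t₀ + ⌈2 * D⌉₊ := by exact_mod_cast hle
        have h2 := Nat.ceil_lt_add_one (show 0 ≤ 2 * D by positivity)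
        linarith
    · have h0 : d (z (t₀ + ⌈2 * D⌉₊)) p = ⌈2 * D⌉₊ := by
        rw [h.symm, hz t₀ _ (by omega) hgt.le, Nat.cast_add]; ring
      have h1 := Nat.le_ceil (2 * D)
      have h2 := Nat.ceil_lt_add_one (show 0 ≤ 2 * D by positivity)
      have h3 := hmax' (t₀ + ⌈2 * D⌉₊) (by omega)
      refine ⟨t₀ + ⌈2 * D⌉₊, f (t₀ + ⌈2 * D⌉₊), by omega, hgt.le, hf _, ?_, h3, by linarith⟩
      have h4 := hDq _ (hf (t₀ + ⌈2 * D⌉₊))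
      simp only [gromovProd]
      rw [h.symm (q _) p]; linarith
  obtain ⟨t₁, i₁, ht₁, hi₁, hg₁, hd₁, hdp₁⟩ := hleft
  obtain ⟨t₂, i₂, ht₂, ht₂m, hi₂, hg₂, hd₂, hdp₂⟩ := hright
  have hzero : gromovProd d p (z t₁) (z t₂) = 0 := by
    simp only [gromovProd]
    rw [h.symm (z t₂) p, hz t₁ t₀ ht₁ ht₀', hz t₀ t₂ ht₂ ht₂m, hz t₁ t₂ (ht₁.trans ht₂) ht₂m]
    ring
  have hdist : d (q i₁) (q i₂) ≤ 6 * D + 2 := by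
    have e1 := h.triangle (q i₁) (z t₁) (q i₂)
    have e2 := h.triangle (z t₁) p (q i₂)
    have e3 := h.triangle p (z t₂) (q i₂)
    rw [h.symm (q i₁) (z t₁)] at e1
    rw [h.symm p (z t₂)] at e3
    linarith
  have hindex : |(i₂ : ℝ) - i₁| ≤ c * (6 * D + 2) := by
    have hc0 : (0 : ℝ) ≤ c := by linarith
    rcases le_total i₁ i₂ with hle | hle
    · rw [abs_of_nonneg (by rw [sub_nonneg]; exact_mod_cast hle)]
      exact ((hq i₁ i₂ hle hi₂).1).trans (mul_le_mul_of_nonneg_left hdist hc0)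
    · rw [abs_sub_comm, abs_of_nonneg (by rw [sub_nonneg]; exact_mod_cast hle)]
      refine ((hq i₂ i₁ hle hi₁).1).trans (mul_le_mul_of_nonneg_left ?_ hc0)
      rw [h.symm]; exact hdist
  -- The scale `k` at which `2 ^ k` beats the linear bound while `k δ` is still below `D`.
  obtain ⟨k, hk1, hk2⟩ : ∃ k : ℕ, (k + 3) * δ + c ≤ D ∧ D < (k + 4) * δ + c := by
    have hδ0 : 0 < δ := by linarith
    have h1 : 3 ≤ ⌊(D - c) / δ⌋₊ := by
      apply Nat.le_floor
      rw [le_div_iff₀ hδ0]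
      push_cast
      nlinarith [(Nat.cast_nonneg k₀ : (0 : ℝ) ≤ k₀)]
    refine ⟨⌊(D - c) / δ⌋₊ - 3, ?_, ?_⟩
    · rw [Nat.cast_sub h1]
      have h2 := Nat.floor_le (show 0 ≤ (D - c) / δ by
        apply div_nonneg _ hδ0.le
        nlinarith [(Nat.cast_nonneg k₀ : (0 : ℝ) ≤ k₀)])
      rw [le_div_iff₀ hδ0] at h2
      push_cast; linarith
    · rw [Nat.cast_sub h1]
      have h2 := Nat.lt_floor_add_one ((D - c) / δ)
      rw [div_lt_iff₀ hδ0] at h2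
      push_cast; linarith
  have hk : k₀ ≤ k := by
    have : (k₀ : ℝ) + 3 < k + 4 := by
      by_contra hh
      push Not at hh
      have := mul_le_mul_of_nonneg_right hh (show 0 ≤ δ by linarith)
      linarith
    have : (k₀ : ℝ) < k + 1 := by linarith
    have : k₀ < k + 1 := by exact_mod_cast this
    omega
  have hpow : c * (6 * D + 2) ≤ 2 ^ k := by
    refine le_trans ?_ (hk₀ k hk)
    have : c * (6 * D + 2) ≤ c * (6 * ((k + 4) * δ + c) + 2) := by gcongr
    linarith
  have h1 := h.le_gromovProd_of_quasiGeodesic (by linarith) hq hDq k i₁ i₂ hi₁ hi₂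
    (hindex.trans hpow)
  have h2 := h.gromov p (z t₁) (q i₁) (q i₂)
  have h3 := h.gromov p (z t₁) (q i₂) (z t₂)
  rw [h.gromovProd_comm p (q i₂) (z t₂)] at h3
  have hkδ : 0 ≤ k * δ := mul_nonneg (Nat.cast_nonneg k) (by linarith)
  have h4 : D - c - k * δ ≤ min (gromovProd d p (z t₁) (q i₁)) (gromovProd d p (q i₁) (q i₂)) :=
    le_min (by linarith) h1
  have h5 : D - c - k * δ - δ ≤
      min (gromovProd d p (z t₁) (q i₂)) (gromovProd d p (z t₂) (q i₂)) :=
    le_min (by linarith) (by linarith)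
  linarith

/-- Stability of quasi-geodesics: the points of a quasi-geodesic lie close to a geodesic with the
same end points, expressed through Gromov products. -/
theorem IsHyperbolicDist.gromovProd_quasiGeodesic_le (h : IsHyperbolicDist d δ)
    (hgeo : ∀ x y, ∃ (m : ℕ) (z : ℕ → X), z 0 = x ∧ z m = y ∧
      ∀ i j, i ≤ j → j ≤ m → d (z i) (z j) = (j : ℝ) - i) {c : ℝ} (hc : 1 ≤ c) :
    ∃ K : ℝ, 0 ≤ K ∧ ∀ (n : ℕ) (q : ℕ → X), QuasiGeodesic d c n q →
      ∀ k ≤ n, gromovProd d (q k) (q 0) (q n) ≤ K := by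
  obtain ⟨D, hD0, hD⟩ := h.geodesic_near_quasiGeodesic hc
  refine ⟨D + c * (c * (2 * D + 1)), by positivity, fun n q hq k hk => ?_⟩
  obtain ⟨m, z, hz0, hzm, hz⟩ := hgeo (q 0) (q n)
  have hnear := hD n m q z hq hz hz0 hzm
  -- A point of the geodesic close to `q k`, found where the nearest index jumps over `k`.
  have hpt : ∃ t ≤ m, d (q k) (z t) ≤ D + c * (c * (2 * D + 1)) := by
    by_contra hcon
    push Not at hcon
    have hall : ∀ t ≤ m, ∃ i ≤ k, d (z t) (q i) ≤ D := by
      intro t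
      induction t with
      | zero => exact fun _ => ⟨0, Nat.zero_le _, by rw [hz0, h.self]; exact hD0⟩
      | succ t ih =>
        intro ht
        obtain ⟨i, hi, hid⟩ := ih (by omega)
        obtain ⟨j, hj, hjd⟩ := hnear (t + 1) ht
        by_cases hjk : j ≤ k
        · exact ⟨j, hjk, hjd⟩
        exfalso
        have e1 := hz t (t + 1) (by omega) ht
        push_cast at e1
        have e2 := h.triangle (q i) (z t) (q j)
        have e3 := h.triangle (z t) (z (t + 1)) (q j)
        rw [h.symm (q i) (z t)] at e2
        have e4 : d (q i) (q j) ≤ 2 * D + 1 := by linarith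
        have e5 := (hq i j (by omega) hj).1
        have e6 := (hq i k hi hk).2
        have e7 := h.triangle (q k) (q i) (z t)
        rw [h.symm (q k) (q i), h.symm (q i) (z t)] at e7
        have e8 : (k : ℝ) ≤ j := by exact_mod_cast (by omega : k ≤ j)
        have e9 : c * ((k : ℝ) - i) ≤ c * (c * (2 * D + 1)) := by
          apply mul_le_mul_of_nonneg_left _ (by linarith)
          have := mul_le_mul_of_nonneg_left e4 (show 0 ≤ c by linarith)
          linarith
        linarith [hcon t (by omega)]
    obtain ⟨i, hi, hid⟩ := hall m le_rfl
    rw [hzm, h.symm] at hid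
    have e1 := (hq i n (by omega) le_rfl).1
    have e2 := (hq k n hk le_rfl).2
    have e3 := hcon m le_rfl
    rw [hzm] at e3
    have e4 : (i : ℝ) ≤ k := by exact_mod_cast hi
    have e5 : c * ((n : ℝ) - k) ≤ c * (c * (2 * D + 1)) := by
      apply mul_le_mul_of_nonneg_left _ (by linarith)
      have := mul_le_mul_of_nonneg_left (show d (q i) (q n) ≤ 2 * D + 1 by linarith)
        (show 0 ≤ c by linarith)
      linarith
    linarith
  obtain ⟨t, ht, htd⟩ := hpt
  have e1 := hz 0 t (Nat.zero_le _) ht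
  have e2 := hz t m ht le_rfl
  have e3 := hz 0 m (Nat.zero_le _) le_rfl
  rw [hz0] at e1 e3
  rw [hzm] at e2 e3
  have e4 := h.triangle (q 0) (z t) (q k)
  have e5 := h.triangle (q n) (z t) (q k)
  rw [h.symm (z t) (q k)] at e4 e5
  rw [h.symm (q n) (z t)] at e5
  simp only [gromovProd]
  linarith

/-- A point near the geodesic between the end points of a quasi-geodesic is near the
quasi-geodesic. -/
theorem IsHyperbolicDist.exists_near_quasiGeodesic (h : IsHyperbolicDist d δ)
    (hgeo : ∀ x y, ∃ (m : ℕ) (z : ℕ → X), z 0 = x ∧ z m = y ∧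
      ∀ i j, i ≤ j → j ≤ m → d (z i) (z j) = (j : ℝ) - i) {c : ℝ} (hc : 1 ≤ c) (K : ℝ) :
    ∃ R : ℝ, ∀ (n : ℕ) (q : ℕ → X), QuasiGeodesic d c n q →
      ∀ p, gromovProd d p (q 0) (q n) ≤ K → ∃ i ≤ n, d p (q i) ≤ R := by
  have hδ := h.one_le
  obtain ⟨K', hK', hq'⟩ := h.gromovProd_quasiGeodesic_le hgeo hc
  refine ⟨K + δ + c + (K' + δ), fun n q hq p hp => ?_⟩
  -- The first index at which `(q 0 | q i)_p` has become small.
  have hex : ∃ i, i ≤ n ∧ gromovProd d p (q 0) (q i) ≤ K + δ := ⟨n, le_rfl, by linarith⟩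
  classical
  set i := Nat.find hex with hi
  obtain ⟨hin, hi1⟩ := Nat.find_spec hex
  rw [← hi] at hin hi1
  have hi2 : gromovProd d p (q i) (q n) ≤ K + δ + c := by
    rcases Nat.eq_zero_or_pos i with h0 | hpos
    · rw [h0]; linarith
    · have h1 : ¬ gromovProd d p (q 0) (q (i - 1)) ≤ K + δ := fun hh =>
        Nat.find_min hex (show i - 1 < Nat.find hex by omega) ⟨by omega, hh⟩
      push Not at h1
      rw [h.gromovProd_comm] at h1 hp
      have h2 := h.gromovProd_le hp (by rwa [h.gromovProd_comm])
      have h3 := (hq (i - 1) i (by omega) hin).2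
      rw [Nat.cast_sub hpos] at h3
      push_cast at h3
      have h4 : c * ((i : ℝ) - (i - 1)) = c := by ring
      rw [h4] at h3
      simp only [gromovProd] at h2 ⊢
      have h5 := h.triangle (q i) (q (i - 1)) p
      have h6 := h.triangle (q (i - 1)) (q i) (q n)
      rw [h.symm (q i) (q (i - 1))] at h5
      rw [h.symm (q n) (q (i - 1))] at h2
      linarith
  have h1 := hq' n q hq i hin
  have h2 := h.gromov (q i) (q 0) p (q n)
  refine ⟨i, hin, ?_⟩
  have h3 : gromovProd d (q i) (q 0) p = d p (q i) - gromovProd d p (q 0) (q i) := by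
    simp only [gromovProd]; rw [h.symm (q i) p]; ring
  have h4 : gromovProd d (q i) p (q n) = d p (q i) - gromovProd d p (q i) (q n) := by
    simp only [gromovProd]; rw [h.symm (q i) p, h.symm (q n) p, h.symm (q i) (q n),
      h.symm p (q n)]; ring
  rw [h3, h4] at h2
  rcases min_choice (d p (q i) - gromovProd d p (q 0) (q i))
    (d p (q i) - gromovProd d p (q i) (q n)) with h5 | h5 <;> rw [h5] at h2 <;> linarith

end Geometry

/-! ### Word lengths -/

theorem wordLength_one (S : Set Γ) : wordLength S (1 : Γ) = 0 :=
  Nat.le_zero.1 (wordLength_le (l := []) ⟨by simp, by simp⟩)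

theorem wordLength_inv_le {S : Set Γ} (hS : Subgroup.closure S = ⊤) (g : Γ) :
    wordLength S g⁻¹ ≤ wordLength S g := by
  obtain ⟨l, hl, hl'⟩ := exists_represents hS g
  rw [← hl', ← List.length_reverse, ← List.length_map (f := fun x : Γ => x⁻¹)]
  refine wordLength_le ⟨fun x hx => ?_, ?_⟩
  · obtain ⟨y, hy, rfl⟩ := List.mem_map.1 hx
    rcases hl.1 y (List.mem_reverse.1 hy) with h | h
    · right; simpa using h
    · left; exact h
  · rw [List.map_reverse, ← List.prod_inv_reverse, hl.2]

theorem wordLength_inv {S : Set Γ} (hS : Subgroup.closure S = ⊤) (g : Γ) :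
    wordLength S g⁻¹ = wordLength S g :=
  le_antisymm (wordLength_inv_le hS g) (by simpa using wordLength_inv_le hS g⁻¹)

theorem wordLength_eq_zero {S : Set Γ} (hS : Subgroup.closure S = ⊤) {g : Γ}
    (h : wordLength S g = 0) : g = 1 := by
  obtain ⟨l, hl, hl'⟩ := exists_represents hS g
  rw [h, List.length_eq_zero_iff] at hl'
  rw [← hl.2, hl', List.prod_nil]

theorem wordLength_le_add_inv_mul {S : Set Γ} (hS : Subgroup.closure S = ⊤) (g h : Γ) :
    wordLength S g ≤ wordLength S h + wordLength S (h⁻¹ * g) := by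
  simpa using wordLength_mul_le hS h (h⁻¹ * g)

theorem wordLength_pow_le {S : Set Γ} (hS : Subgroup.closure S = ⊤) (g : Γ) (n : ℕ) :
    wordLength S (g ^ n) ≤ n * wordLength S g := by
  induction n with
  | zero => simp [wordLength_one]
  | succ n ih =>
    rw [pow_succ]
    have := wordLength_mul_le hS (g ^ n) g
    linarith

/-- Two word metrics of a finitely generated group are Lipschitz equivalent. -/
theorem exists_wordLength_le_mul {S T : Set Γ} (hS : Subgroup.closure S = ⊤)
    (hT : Subgroup.closure T = ⊤) (hSfin : S.Finite) :
    ∃ c : ℕ, 1 ≤ c ∧ ∀ g, wordLength T g ≤ c * wordLength S g := by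
  obtain ⟨M, hM⟩ := (hSfin.image (wordLength T)).bddAbove
  refine ⟨M + 1, by omega, fun g => ?_⟩
  obtain ⟨l, ⟨hl, rfl⟩, hl'⟩ := exists_represents hS g
  rw [← hl']
  clear hl'
  induction l with
  | nil => simp [wordLength_one]
  | cons x l ih =>
    have h1 : wordLength T x ≤ M := by
      rcases hl x (by simp) with h | h
      · exact hM ⟨x, h, rfl⟩
      · rw [← wordLength_inv hT]; exact hM ⟨x⁻¹, h, rfl⟩
    have h2 := ih fun y hy => hl y (by simp [hy])
    have h3 := wordLength_mul_le hT x l.prod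
    rw [List.prod_cons, List.length_cons]
    nlinarith

theorem finite_wordLength_le {S : Set Γ} (hS : Subgroup.closure S = ⊤) (hSfin : S.Finite)
    (n : ℕ) : {g : Γ | wordLength S g ≤ n}.Finite := by
  induction n with
  | zero =>
    exact (Set.finite_singleton 1).subset fun g hg => wordLength_eq_zero hS (Nat.le_zero.1 hg)
  | succ n ih =>
    refine (((hSfin.union hSfin.inv).image2 (· * ·) ih).union ih).subset fun g hg => ?_
    obtain ⟨l, ⟨hl, rfl⟩, hl'⟩ := exists_represents hS g
    rw [Set.mem_ofPred_eq, ← hl'] at hg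
    cases l with
    | nil => right; simp [wordLength_one]
    | cons x l =>
      left
      refine ⟨x, by simpa using hl x (by simp), l.prod, ?_, by simp⟩
      refine (wordLength_le ⟨fun y hy => hl y (by simp [hy]), rfl⟩).trans ?_
      simpa using hg

/-- If `g` lies on a geodesic from `1` to `g * c`, there is a geodesic path through `g`. -/
theorem exists_geodesic_through {S : Set Γ} (hS : Subgroup.closure S = ⊤) {g c : Γ}
    (hgc : wordLength S (g * c) = wordLength S g + wordLength S c) :
    ∃ q : ℕ → Γ, q 0 = 1 ∧ q (wordLength S g) = g ∧ q (wordLength S (g * c)) = g * c ∧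
      ∀ i j, i ≤ j → j ≤ wordLength S (g * c) → wordLength S ((q i)⁻¹ * q j) = j - i := by
  obtain ⟨l, hl, hl'⟩ := exists_represents hS g
  obtain ⟨m, hm, hm'⟩ := exists_represents hS c
  have hlen : (l ++ m).length = wordLength S (g * c) := by simp [hl', hm', hgc]
  have hmem : ∀ x ∈ l ++ m, x ∈ S ∨ x⁻¹ ∈ S := by
    intro x hx
    rcases List.mem_append.1 hx with hx | hx
    · exact hl.1 x hx
    · exact hm.1 x hx
  have hend : ((l ++ m).take (wordLength S (g * c))).prod = g * c := by
    rw [← hlen, List.take_length, List.prod_append, hl.2, hm.2]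
  have hle : ∀ i j, i ≤ j →
      wordLength S (((l ++ m).take i).prod⁻¹ * ((l ++ m).take j).prod) ≤ j - i := by
    intro i j hij
    have h1 : ((l ++ m).take j) = (l ++ m).take i ++ ((l ++ m).drop i).take (j - i) := by
      conv_lhs => rw [← Nat.add_sub_cancel' hij]
      rw [List.take_add]
    rw [h1, List.prod_append, inv_mul_cancel_left]
    refine (wordLength_le ⟨fun x hx => hmem x ?_, rfl⟩).trans (List.length_take_le _ _)
    exact List.mem_of_mem_drop (List.mem_of_mem_take hx)
  refine ⟨fun i => ((l ++ m).take i).prod, by simp, ?_, hend, fun i j hij hj => ?_⟩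
  · simp [← hl', hl.2]
  · refine le_antisymm (hle i j hij) ?_
    beta_reduce
    have h0 := hle 0 i (Nat.zero_le _)
    have h1 := hle j _ hj
    simp only [List.take_zero, List.prod_nil, inv_one, one_mul] at h0
    rw [hend] at h1
    have h2 := wordLength_le_add_inv_mul hS (g * c) ((l ++ m).take i).prod
    have h3 := wordLength_mul_le hS (((l ++ m).take i).prod⁻¹ * ((l ++ m).take j).prod)
      (((l ++ m).take j).prod⁻¹ * (g * c))
    rw [mul_assoc, mul_inv_cancel_left] at h3
    omega

theorem exists_geodesic {S : Set Γ} (hS : Subgroup.closure S = ⊤) (g : Γ) :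
    ∃ q : ℕ → Γ, q 0 = 1 ∧ q (wordLength S g) = g ∧
      ∀ i j, i ≤ j → j ≤ wordLength S g → wordLength S ((q i)⁻¹ * q j) = j - i := by
  obtain ⟨q, h0, h1, -, h3⟩ := exists_geodesic_through hS (g := g) (c := 1)
    (by simp [wordLength_one])
  exact ⟨q, h0, h1, by simpa using h3⟩

/-! ### Stable translation lengths -/

theorem tendsto_wordLength_pow_div {S : Set Γ} (hS : Subgroup.closure S = ⊤) (g : Γ) :
    Tendsto (fun n : ℕ => (wordLength S (g ^ n) : ℝ) / n) atTop (𝓝 (translationLength S g)) := by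
  simpa [wordDist, wordLength_inv hS] using tendsto_translationLength hS g

theorem translationLength_nonneg {S : Set Γ} (hS : Subgroup.closure S = ⊤) (g : Γ) :
    0 ≤ translationLength S g :=
  ge_of_tendsto' (tendsto_wordLength_pow_div hS g) fun n => by positivity

theorem translationLength_pow {S : Set Γ} (hS : Subgroup.closure S = ⊤) (g : Γ) (n : ℕ) :
    translationLength S (g ^ n) = n * translationLength S g := by
  rcases Nat.eq_zero_or_pos n with rfl | hn
  · refine tendsto_nhds_unique (tendsto_wordLength_pow_div hS _) ?_
    simp [wordLength_one]
  · refine tendsto_nhds_unique (tendsto_wordLength_pow_div hS _) ?_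
    have h1 := ((tendsto_wordLength_pow_div hS g).comp
      (tendsto_id.const_mul_atTop' hn)).const_mul (n : ℝ)
    refine h1.congr fun k => ?_
    have : (n : ℝ) ≠ 0 := by positivity
    simp only [Function.comp, id, Nat.cast_mul, ← pow_mul]
    rw [← mul_div_assoc, mul_div_mul_left _ _ this]

theorem translationLength_inv {S : Set Γ} (hS : Subgroup.closure S = ⊤) (g : Γ) :
    translationLength S g⁻¹ = translationLength S g := by
  refine tendsto_nhds_unique (tendsto_wordLength_pow_div hS _) ?_
  simpa [wordLength_inv hS] using tendsto_wordLength_pow_div hS g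

theorem translationLength_le {S : Set Γ} (hS : Subgroup.closure S = ⊤) (g : Γ) :
    translationLength S g ≤ wordLength S g := by
  refine le_of_tendsto (tendsto_wordLength_pow_div hS g) ?_
  filter_upwards [eventually_gt_atTop 0] with n hn
  rw [div_le_iff₀ (by exact_mod_cast hn)]
  have := wordLength_pow_le hS g n
  rw [mul_comm]
  exact_mod_cast this

/-- A bound `|gⁿ|_T ≤ r |gⁿ|_S + C` for all `n` passes to the stable translation lengths. -/
theorem translationLength_le_mul {S T : Set Γ} (hS : Subgroup.closure S = ⊤)
    (hT : Subgroup.closure T = ⊤) {g : Γ} {r C : ℝ}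
    (h : ∀ n : ℕ, (wordLength T (g ^ n) : ℝ) ≤ r * wordLength S (g ^ n) + C) :
    translationLength T g ≤ r * translationLength S g := by
  have h1 := ((tendsto_wordLength_pow_div hS g).const_mul r).add
    (tendsto_const_div_atTop_nhds_zero_nat C)
  rw [add_zero] at h1
  refine le_of_tendsto_of_tendsto' (tendsto_wordLength_pow_div hT g) h1 fun n => ?_
  rw [← mul_div_assoc, ← add_div]
  exact div_le_div_of_nonneg_right (h n) (Nat.cast_nonneg n)

/-- If the length of `u * g ^ n` is affine in `n`, its slope is the stable translation length
of `g`. -/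
theorem translationLength_eq_of_forall {S : Set Γ} (hS : Subgroup.closure S = ⊤) {g : Γ} (u : Γ)
    {r C : ℝ} (h : ∀ n : ℕ, (wordLength S (u * g ^ n) : ℝ) = n * r + C) :
    translationLength S g = r := by
  have hlim : ∀ B : ℝ, Tendsto (fun n : ℕ => ((n : ℝ) * r + B) / n) atTop (𝓝 r) := by
    intro B
    have h1 := (tendsto_const_nhds (x := r)).add (tendsto_const_div_atTop_nhds_zero_nat B)
    rw [add_zero] at h1
    refine h1.congr' ?_
    filter_upwards [eventually_gt_atTop 0] with n hn
    have : (n : ℝ) ≠ 0 := by positivity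
    field_simp
  refine le_antisymm ?_ ?_
  · refine le_of_tendsto_of_tendsto' (tendsto_wordLength_pow_div hS g)
      (hlim (C + wordLength S u)) fun n => ?_
    refine div_le_div_of_nonneg_right ?_ (Nat.cast_nonneg n)
    have h1 := wordLength_mul_le hS u⁻¹ (u * g ^ n)
    rw [inv_mul_cancel_left, wordLength_inv hS] at h1
    have h2 : (wordLength S (g ^ n) : ℝ) ≤ wordLength S u + wordLength S (u * g ^ n) := by
      exact_mod_cast h1
    linarith [h n]
  · refine le_of_tendsto_of_tendsto' (hlim (C - wordLength S u))
      (tendsto_wordLength_pow_div hS g) fun n => ?_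
    refine div_le_div_of_nonneg_right ?_ (Nat.cast_nonneg n)
    have h1 := wordLength_mul_le hS u (g ^ n)
    have h2 : (wordLength S (u * g ^ n) : ℝ) ≤ wordLength S u + wordLength S (g ^ n) := by
      exact_mod_cast h1
    linarith [h n]

theorem exists_translationLength_le_mul {S T : Set Γ} (hS : Subgroup.closure S = ⊤)
    (hT : Subgroup.closure T = ⊤) (hSfin : S.Finite) :
    ∃ c : ℝ, 0 < c ∧ ∀ g, translationLength T g ≤ c * translationLength S g := by
  obtain ⟨c, hc, h⟩ := exists_wordLength_le_mul hS hT hSfin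
  refine ⟨c, by positivity, fun g => translationLength_le_mul hS hT (C := 0) fun n => ?_⟩
  rw [add_zero]
  exact_mod_cast h (g ^ n)

theorem translationLength_pos_of_pos {S T : Set Γ} (hS : Subgroup.closure S = ⊤)
    (hT : Subgroup.closure T = ⊤) (hTfin : T.Finite) {g : Γ} (h : 0 < translationLength S g) :
    0 < translationLength T g := by
  obtain ⟨c, hc, hle⟩ := exists_translationLength_le_mul hT hS hTfin
  have := hle g
  by_contra hcon
  nlinarith

theorem not_isOfFinOrder_of_translationLength_pos {S : Set Γ} (hS : Subgroup.closure S = ⊤)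
    {g : Γ} (h : 0 < translationLength S g) : ¬ IsOfFinOrder g := by
  intro hg
  obtain ⟨n, hn, hgn⟩ := isOfFinOrder_iff_pow_eq_one.1 hg
  have h1 := translationLength_pow hS g n
  have h2 := translationLength_pow hS g 0
  rw [hgn] at h1
  rw [pow_zero] at h2
  rw [h2] at h1
  have : (0 : ℝ) < n * translationLength S g := by positivity
  simp at h1
  rcases h1 with h1 | h1
  · omega
  · linarith

/-! ### The hyperbolic word metric and geodesics of other word metrics -/

/-- The word metric as a real-valued function. -/
noncomputable def realDist (S : Set Γ) (x y : Γ) : ℝ := wordDist S x y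

theorem realDist_one_left (S : Set Γ) (x : Γ) : realDist S 1 x = wordLength S x := by
  simp [realDist, wordDist]

theorem realDist_mul_left (S : Set Γ) (g x y : Γ) :
    realDist S (g * x) (g * y) = realDist S x y := by
  simp [realDist, wordDist, mul_assoc]

theorem gromovProd_mul_left (S : Set Γ) (g p x y : Γ) :
    gromovProd (realDist S) (g * p) (g * x) (g * y) = gromovProd (realDist S) p x y := by
  simp only [gromovProd, realDist_mul_left]

theorem FourPoint.isHyperbolicDist {S : Set Γ} (hS : Subgroup.closure S = ⊤) {δ : ℝ}
    (h : FourPoint S δ) : IsHyperbolicDist (realDist S) (max 1 δ) where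
  one_le := le_max_left _ _
  self x := by simp [realDist, wordDist, wordLength_one]
  symm x y := by
    simp only [realDist, wordDist]
    rw [← wordLength_inv hS, mul_inv_rev, inv_inv]
  triangle x y z := by
    have := wordLength_mul_le hS (x⁻¹ * y) (y⁻¹ * z)
    rw [mul_assoc, mul_inv_cancel_left] at this
    simp only [realDist, wordDist]
    exact_mod_cast this
  gromov p x y z := by
    have h1 := h x z y p
    have h2 : (wordDist S z y : ℝ) = wordDist S y z := by
      simp only [wordDist]
      rw [← wordLength_inv hS, mul_inv_rev, inv_inv]
    simp only [gromovProd, realDist]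
    have h3 := le_max_left 1 δ
    have h4 := le_max_right 1 δ
    rcases max_choice ((wordDist S x y : ℝ) + wordDist S z p)
      ((wordDist S x p : ℝ) + wordDist S z y) with h5 | h5 <;> rw [h5] at h1
    · have h6 := min_le_left (((wordDist S x p : ℝ) + wordDist S y p - wordDist S x y) / 2)
        (((wordDist S y p : ℝ) + wordDist S z p - wordDist S y z) / 2)
      linarith
    · have h6 := min_le_right (((wordDist S x p : ℝ) + wordDist S y p - wordDist S x y) / 2)
        (((wordDist S y p : ℝ) + wordDist S z p - wordDist S y z) / 2)
      linarith

theorem exists_realDist_geodesic {S : Set Γ} (hS : Subgroup.closure S = ⊤) (x y : Γ) :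
    ∃ (m : ℕ) (z : ℕ → Γ), z 0 = x ∧ z m = y ∧
      ∀ i j, i ≤ j → j ≤ m → realDist S (z i) (z j) = (j : ℝ) - i := by
  obtain ⟨q, h0, h1, h2⟩ := exists_geodesic hS (x⁻¹ * y)
  refine ⟨wordLength S (x⁻¹ * y), fun i => x * q i, by simp [h0], by simp [h1],
    fun i j hij hj => ?_⟩
  rw [realDist_mul_left, realDist, wordDist, h2 i j hij hj, Nat.cast_sub hij]

/-- A geodesic of one word metric is a quasi-geodesic for any other. -/
theorem exists_forall_quasiGeodesic {S₀ S : Set Γ} (hS₀ : Subgroup.closure S₀ = ⊤)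
    (hS : Subgroup.closure S = ⊤) (hfin₀ : S₀.Finite) (hfin : S.Finite) :
    ∃ c : ℝ, 1 ≤ c ∧ ∀ (n : ℕ) (q : ℕ → Γ),
      (∀ i j, i ≤ j → j ≤ n → wordLength S ((q i)⁻¹ * q j) = j - i) →
        QuasiGeodesic (realDist S₀) c n q := by
  obtain ⟨c, hc, h⟩ := exists_wordLength_le_mul hS₀ hS hfin₀
  obtain ⟨c', hc', h'⟩ := exists_wordLength_le_mul hS hS₀ hfin
  refine ⟨max c c', le_max_of_le_left (by exact_mod_cast hc), fun n q hq i j hij hj => ?_⟩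
  have e := hq i j hij hj
  have e' : ((j : ℝ) - i) = wordLength S ((q i)⁻¹ * q j) := by
    rw [e, Nat.cast_sub hij]
  rw [e']
  simp only [realDist, wordDist]
  constructor
  · refine le_trans (b := (c : ℝ) * wordLength S₀ ((q i)⁻¹ * q j)) (by exact_mod_cast h _) ?_
    exact mul_le_mul_of_nonneg_right (le_max_left _ _) (by positivity)
  · refine le_trans (b := (c' : ℝ) * wordLength S ((q i)⁻¹ * q j)) (by exact_mod_cast h' _) ?_
    exact mul_le_mul_of_nonneg_right (le_max_right _ _) (by positivity)

/-- Some `S`-geodesic from `1` to `u * v` meets the `S₀`-ball of radius `R` around `u`. -/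
def PassesNear (S₀ S : Set Γ) (R : ℕ) (u v : Γ) : Prop :=
  ∃ b, wordLength S₀ b ≤ R ∧
    wordLength S (u * v) = wordLength S (u * b) + wordLength S (b⁻¹ * v)

theorem PassesNear.mono {S₀ S : Set Γ} {R R' : ℕ} (h : R ≤ R') {u v : Γ}
    (hp : PassesNear S₀ S R u v) : PassesNear S₀ S R' u v := by
  obtain ⟨b, hb, hb'⟩ := hp
  exact ⟨b, hb.trans h, hb'⟩

theorem exists_passesNear {S₀ S : Set Γ} (hS₀ : Subgroup.closure S₀ = ⊤)
    (hS : Subgroup.closure S = ⊤) (hfin₀ : S₀.Finite) (hfin : S.Finite) {δ : ℝ}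
    (hδ : IsHyperbolicDist (realDist S₀) δ) (K : ℝ) :
    ∃ R : ℕ, ∀ u v : Γ, gromovProd (realDist S₀) 1 u⁻¹ v ≤ K → PassesNear S₀ S R u v := by
  obtain ⟨c, hc, hq⟩ := exists_forall_quasiGeodesic hS₀ hS hfin₀ hfin
  obtain ⟨R, hR⟩ := hδ.exists_near_quasiGeodesic (exists_realDist_geodesic hS₀) hc K
  refine ⟨⌊R⌋₊, fun u v huv => ?_⟩
  obtain ⟨q, h0, h1, h2⟩ := exists_geodesic hS (u * v)
  rw [← gromovProd_mul_left S₀ u] at huv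
  obtain ⟨i, hi, hid⟩ := hR _ q (hq _ q h2) u (by simpa [h0, h1] using huv)
  refine ⟨u⁻¹ * q i, Nat.le_floor hid, ?_⟩
  have e1 := h2 0 i (Nat.zero_le _) hi
  have e2 := h2 i _ hi le_rfl
  rw [h0] at e1
  rw [h1] at e2
  rw [mul_inv_cancel_left, mul_inv_rev, inv_inv, mul_assoc, e2]
  simp at e1
  omega

/-- Points on an `S`-geodesic have bounded Gromov products in the hyperbolic metric. -/
theorem exists_gromovProd_le_of_cone {S₀ S : Set Γ} (hS₀ : Subgroup.closure S₀ = ⊤)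
    (hS : Subgroup.closure S = ⊤) (hfin₀ : S₀.Finite) (hfin : S.Finite) {δ : ℝ}
    (hδ : IsHyperbolicDist (realDist S₀) δ) :
    ∃ K : ℝ, 0 ≤ K ∧ ∀ g c : Γ, wordLength S (g * c) = wordLength S g + wordLength S c →
      gromovProd (realDist S₀) 1 g⁻¹ c ≤ K := by
  obtain ⟨c, hc, hq⟩ := exists_forall_quasiGeodesic hS₀ hS hfin₀ hfin
  obtain ⟨K, hK0, hK⟩ := hδ.gromovProd_quasiGeodesic_le (exists_realDist_geodesic hS₀) hc
  refine ⟨K, hK0, fun g c hgc => ?_⟩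
  obtain ⟨q, h0, h1, h2, h3⟩ := exists_geodesic_through hS hgc
  have := hK _ q (hq _ q h3) (wordLength S g) (by omega)
  rw [h0, h1, h2, ← gromovProd_mul_left S₀ g⁻¹] at this
  simpa using this

/-! ### Local types -/

/-- The `S`-type of `u`: the relative `S`-lengths of the elements of the `S₀`-ball of radius `R`
around `u`. -/
noncomputable def localType (S₀ S : Set Γ) (R : ℕ) (u : Γ) :
    {b : Γ // wordLength S₀ b ≤ R} → ℤ :=
  fun b => (wordLength S (u * b) : ℤ) - wordLength S u

theorem finite_range_localType {S₀ S : Set Γ} (hS₀ : Subgroup.closure S₀ = ⊤)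
    (hS : Subgroup.closure S = ⊤) (hfin₀ : S₀.Finite) (R : ℕ) :
    (Set.range (localType S₀ S R)).Finite := by
  have hfin : Finite {b : Γ // wordLength S₀ b ≤ R} := finite_wordLength_le hS₀ hfin₀ R
  refine (Set.Finite.pi' (t := fun b : {b : Γ // wordLength S₀ b ≤ R} =>
    Set.Icc (-(wordLength S (b : Γ) : ℤ)) (wordLength S (b : Γ)))
    fun b => Set.finite_Icc _ _).subset ?_
  rintro _ ⟨u, rfl⟩ b
  have h1 := wordLength_mul_le hS u b
  have h2 := wordLength_mul_le hS (u * b) (b : Γ)⁻¹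
  rw [mul_inv_cancel_right, wordLength_inv hS] at h2
  simp only [localType, Set.mem_Icc]
  omega

/-- The type of `u` determines the relative length of `u * v` whenever geodesics to `u * v` pass
near `u`. -/
theorem wordLength_sub_eq_of_localType_eq {S₀ S : Set Γ} (hS : Subgroup.closure S = ⊤) {R : ℕ}
    {u u' v : Γ} (h : localType S₀ S R u = localType S₀ S R u') (hu : PassesNear S₀ S R u v)
    (hu' : PassesNear S₀ S R u' v) :
    (wordLength S (u * v) : ℤ) - wordLength S u = wordLength S (u' * v) - wordLength S u' := by
  have key : ∀ u u' : Γ, localType S₀ S R u = localType S₀ S R u' → PassesNear S₀ S R u v →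
      (wordLength S (u' * v) : ℤ) - wordLength S u' ≤ wordLength S (u * v) - wordLength S u := by
    intro u u' h hu
    obtain ⟨b, hb, hbv⟩ := hu
    have h1 := congrFun h ⟨b, hb⟩
    simp only [localType] at h1
    have h2 := wordLength_mul_le hS (u' * b) (b⁻¹ * v)
    rw [mul_assoc, mul_inv_cancel_left] at h2
    omega
  exact le_antisymm (key u' u h.symm hu') (key u u' h hu)

/-- Pigeonhole principle for maps with finite range, with a bound that is uniform over all
sequences. -/
theorem exists_repeat_of_finite_range {α β : Type*} {F : α → β} (hF : (Set.range F).Finite) :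
    ∃ N : ℕ, ∀ x : ℕ → α, ∃ i j, i < j ∧ j ≤ N ∧ F (x i) = F (x j) := by
  refine ⟨hF.toFinset.card, fun x => ?_⟩
  obtain ⟨i, hi, j, hj, hij, he⟩ := Finset.exists_ne_map_eq_of_card_lt_of_maps_to
    (s := Finset.range (hF.toFinset.card + 1)) (t := hF.toFinset) (f := fun i => F (x i))
    (by simp) (fun i _ => by simp)
  simp only [Finset.mem_range] at hi hj
  rcases lt_or_gt_of_ne hij with h | h
  · exact ⟨i, j, h, by omega, he⟩
  · exact ⟨j, i, h, by omega, he.symm⟩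

/-! ### Cones and the attainment of the dilation -/

/-- `c` belongs to the cone of `g`: some geodesic from `1` to `g * c` passes through `g`. -/
def InCone (S : Set Γ) (g c : Γ) : Prop :=
  wordLength S (g * c) = wordLength S g + wordLength S c

/-- `g` and `h` have the same `S`-cone, and `T`-lengths grow in the same way along it. -/
def ConeEquiv (S T : Set Γ) (g h : Γ) : Prop :=
  (∀ c, InCone S g c ↔ InCone S h c) ∧
    ∀ c, InCone S g c →
      (wordLength T (g * c) : ℤ) - wordLength T g = wordLength T (h * c) - wordLength T h

theorem inCone_mul_iff {S : Set Γ} (hS : Subgroup.closure S = ⊤) {g c s : Γ}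
    (h : wordLength S (c * s) = wordLength S c + wordLength S s) :
    InCone S g (c * s) ↔ InCone S g c ∧ InCone S (g * c) s := by
  have h1 := wordLength_mul_le hS g c
  have h2 := wordLength_mul_le hS (g * c) s
  simp only [InCone, ← mul_assoc, h]
  omega

theorem InCone.mul {S : Set Γ} (hS : Subgroup.closure S = ⊤) {g c s : Γ} (h1 : InCone S g c)
    (h2 : InCone S (g * c) s) :
    InCone S g (c * s) ∧ wordLength S (c * s) = wordLength S c + wordLength S s := by
  have h : wordLength S (c * s) = wordLength S c + wordLength S s := by
    have h3 := wordLength_mul_le hS c s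
    have h4 := wordLength_mul_le hS g (c * s)
    simp only [InCone] at h1 h2
    rw [← mul_assoc] at h4
    omega
  exact ⟨(inCone_mul_iff hS h).2 ⟨h1, h2⟩, h⟩

theorem ConeEquiv.trans {S T : Set Γ} {g h k : Γ} (h1 : ConeEquiv S T g h)
    (h2 : ConeEquiv S T h k) : ConeEquiv S T g k :=
  ⟨fun c => (h1.1 c).trans (h2.1 c),
    fun c hc => (h1.2 c hc).trans (h2.2 c ((h1.1 c).1 hc))⟩

theorem ConeEquiv.refl (S T : Set Γ) (g : Γ) : ConeEquiv S T g g :=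
  ⟨fun _ => Iff.rfl, fun _ _ => rfl⟩

theorem ConeEquiv.mul_right {S T : Set Γ} (hS : Subgroup.closure S = ⊤) {g h w : Γ}
    (hgh : ConeEquiv S T g h) (hw : InCone S g w) : ConeEquiv S T (g * w) (h * w) := by
  have hw' := (hgh.1 w).1 hw
  refine ⟨fun c => ⟨fun hc => ?_, fun hc => ?_⟩, fun c hc => ?_⟩
  · have h1 := hw.mul hS hc
    exact ((inCone_mul_iff hS h1.2).1 ((hgh.1 _).1 h1.1)).2
  · have h1 := hw'.mul hS hc
    exact ((inCone_mul_iff hS h1.2).1 ((hgh.1 _).2 h1.1)).2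
  · have h1 := hgh.2 _ (hw.mul hS hc).1
    have h2 := hgh.2 w hw
    simp only [← mul_assoc] at h1
    linarith

/-- Local types of bounded radius determine the cone and the growth of lengths along it. The cone
is recovered by induction along geodesics, because adding one letter to an element of the cone
keeps geodesics near the base point. -/
theorem exists_localType_coneEquiv {S₀ S T : Set Γ} (hS₀ : Subgroup.closure S₀ = ⊤)
    (hS : Subgroup.closure S = ⊤) (hT : Subgroup.closure T = ⊤) (hfin₀ : S₀.Finite)
    (hSfin : S.Finite) (hTfin : T.Finite) {δ : ℝ} (hδ : IsHyperbolicDist (realDist S₀) δ) :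
    ∃ R : ℕ, ∀ g h : Γ, localType S₀ S R g = localType S₀ S R h →
      localType S₀ T R g = localType S₀ T R h → ConeEquiv S T g h := by
  obtain ⟨K, -, hK⟩ := exists_gromovProd_le_of_cone hS₀ hS hfin₀ hSfin hδ
  obtain ⟨A, -, hA⟩ := exists_wordLength_le_mul hS hS₀ hSfin
  obtain ⟨R₁, hR₁⟩ := exists_passesNear hS₀ hS hfin₀ hSfin hδ (K + A)
  obtain ⟨R₂, hR₂⟩ := exists_passesNear hS₀ hT hfin₀ hTfin hδ K
  have hcone : ∀ g h : Γ, localType S₀ S (max R₁ R₂) g = localType S₀ S (max R₁ R₂) h →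
      ∀ (n : ℕ) (c : Γ), wordLength S c = n → InCone S g c → InCone S h c := by
    intro g h hgh n
    induction n with
    | zero =>
      intro c hc _
      rw [wordLength_eq_zero hS hc]
      simp [InCone, wordLength_one]
    | succ n ih =>
      intro c hc hgc
      obtain ⟨q, h0, h1, h2⟩ := exists_geodesic hS c
      have e1 := h2 0 n (Nat.zero_le _) (by omega)
      have e2 := h2 n (wordLength S c) (by omega) le_rfl
      rw [h1] at e2
      simp only [h0, inv_one, one_mul] at e1
      have hmul : q n * ((q n)⁻¹ * c) = c := mul_inv_cancel_left _ _
      have hsum : wordLength S (q n * ((q n)⁻¹ * c)) =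
          wordLength S (q n) + wordLength S ((q n)⁻¹ * c) := by rw [hmul]; omega
      rw [← hmul, inCone_mul_iff hS hsum] at hgc
      have hg' := hgc.1
      have hh' := ih (q n) (by omega) hg'
      have hstep : realDist S₀ (q n) c ≤ A := by
        have := hA ((q n)⁻¹ * c)
        rw [e2, hc] at this
        simp only [realDist, wordDist]
        norm_num at this
        exact_mod_cast this
      have hpass : ∀ x, InCone S x (q n) → PassesNear S₀ S (max R₁ R₂) x c := by
        intro x hx
        refine (hR₁ x c ?_).mono (le_max_left _ _)
        have := hδ.gromovProd_le_add 1 x⁻¹ (q n) c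
        linarith [hK x (q n) hx]
      have e3 := wordLength_sub_eq_of_localType_eq hS hgh (hpass g hg') (hpass h hh')
      have e4 := (inCone_mul_iff hS hsum).2 hgc
      rw [hmul] at e4
      simp only [InCone] at e4 ⊢
      omega
  refine ⟨max R₁ R₂, fun g h hS' hT' => ⟨fun c => ⟨fun hc => hcone g h hS' _ c rfl hc,
    fun hc => hcone h g hS'.symm _ c rfl hc⟩, fun c hc => ?_⟩⟩
  exact wordLength_sub_eq_of_localType_eq hT hT'
    ((hR₂ g c (hK g c hc)).mono (le_max_right _ _))
    ((hR₂ h c (hK h c (hcone g h hS' _ c rfl hc))).mono (le_max_right _ _))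

/-- Every sufficiently long geodesic contains a short subword joining equivalent points. -/
theorem exists_loop {S₀ S T : Set Γ} (hS₀ : Subgroup.closure S₀ = ⊤)
    (hS : Subgroup.closure S = ⊤) (hT : Subgroup.closure T = ⊤) (hfin₀ : S₀.Finite)
    (hSfin : S.Finite) (hTfin : T.Finite) {δ : ℝ} (hδ : IsHyperbolicDist (realDist S₀) δ) :
    ∃ N : ℕ, ∀ x c : Γ, InCone S x c → N ≤ wordLength S c → ∃ c₁ w c₂ : Γ,
      c = c₁ * w * c₂ ∧ wordLength S c = wordLength S c₁ + wordLength S w + wordLength S c₂ ∧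
      0 < wordLength S w ∧ wordLength S w ≤ N ∧ ConeEquiv S T (x * c₁) (x * c₁ * w) := by
  obtain ⟨R, hR⟩ := exists_localType_coneEquiv hS₀ hS hT hfin₀ hSfin hTfin hδ
  have hfin : (Set.range fun u : Γ => (localType S₀ S R u, localType S₀ T R u)).Finite :=
    ((finite_range_localType hS₀ hS hfin₀ R).prod
      (finite_range_localType hS₀ hT hfin₀ R)).subset (by
        rintro _ ⟨u, rfl⟩
        exact ⟨⟨u, rfl⟩, ⟨u, rfl⟩⟩)
  obtain ⟨N, hN⟩ := exists_repeat_of_finite_range hfin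
  refine ⟨N, fun x c hxc hc => ?_⟩
  obtain ⟨q, h0, h1, h2⟩ := exists_geodesic hS c
  obtain ⟨i, j, hij, hj, he⟩ := hN fun i => x * q i
  rw [Prod.mk.injEq] at he
  have e1 := h2 0 i (Nat.zero_le _) (by omega)
  have e2 := h2 i j hij.le (by omega)
  have e3 := h2 j _ (by omega) le_rfl
  rw [h0, inv_one, one_mul] at e1
  rw [h1] at e3
  refine ⟨q i, (q i)⁻¹ * q j, (q j)⁻¹ * c, by group, by omega, by omega, by omega, ?_⟩
  rw [mul_assoc, mul_inv_cancel_left]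
  exact hR _ _ he.1 he.2

/-- A geodesic word joining equivalent points can be repeated for ever; its length and the growth
of `T`-lengths along it are its translation lengths. -/
theorem translationLength_of_loop {S T : Set Γ} (hS : Subgroup.closure S = ⊤)
    (hT : Subgroup.closure T = ⊤) {x w : Γ} (hw : InCone S x w)
    (hx : ConeEquiv S T x (x * w)) :
    translationLength S w = wordLength S w ∧
      translationLength T w = wordLength T (x * w) - wordLength T x := by
  have key : ∀ n : ℕ, ConeEquiv S T x (x * w ^ n) ∧
      wordLength S (x * w ^ n) = wordLength S x + n * wordLength S w ∧
      (wordLength T (x * w ^ n) : ℤ) =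
        wordLength T x + n * (wordLength T (x * w) - wordLength T x) := by
    intro n
    induction n with
    | zero => simpa using ConeEquiv.refl S T x
    | succ n ih =>
      obtain ⟨h1, h2, h3⟩ := ih
      have h4 := (h1.1 w).1 hw
      have h5 := h1.2 w hw
      rw [pow_succ, ← mul_assoc]
      refine ⟨hx.trans (h1.mul_right hS hw), ?_, ?_⟩
      · simp only [InCone] at h4
        rw [h4, h2]; ring
      · push_cast
        linear_combination h3 - h5
  constructor
  · refine translationLength_eq_of_forall hS x (C := wordLength S x) fun n => ?_
    rw [(key n).2.1]; push_cast; ring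
  · refine translationLength_eq_of_forall hT x (C := wordLength T x) fun n => ?_
    have := (key n).2.2
    have h' : ((wordLength T (x * w ^ n) : ℤ) : ℝ) =
        ((wordLength T x + n * (wordLength T (x * w) - wordLength T x) : ℤ) : ℝ) := by rw [this]
    push_cast at h'
    linarith

/-- The ratio of stable translation lengths attains its supremum: along a long geodesic, short
loops can be cut out one after the other, and each of them is itself a group element whose ratio
is among finitely many. -/
theorem exists_forall_translationLength_mul_le [Infinite Γ] {S₀ S T : Set Γ}
    (hS₀ : Subgroup.closure S₀ = ⊤)
    (hS : Subgroup.closure S = ⊤) (hT : Subgroup.closure T = ⊤) (hfin₀ : S₀.Finite)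
    (hSfin : S.Finite) (hTfin : T.Finite) {δ : ℝ} (hδ : IsHyperbolicDist (realDist S₀) δ) :
    ∃ w : Γ, 0 < translationLength S w ∧ ∀ g : Γ,
      translationLength T g ≤ translationLength T w / translationLength S w *
        translationLength S g := by
  obtain ⟨N, hN⟩ := exists_loop hS₀ hS hT hfin₀ hSfin hTfin hδ
  obtain ⟨A, -, hA⟩ := exists_wordLength_le_mul hS hT hSfin
  set W : Set Γ := {w | 0 < wordLength S w ∧ wordLength S w ≤ N ∧
    ∃ x, InCone S x w ∧ ConeEquiv S T x (x * w)} with hW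
  have hWfin : W.Finite := (finite_wordLength_le hS hSfin N).subset fun w hw => hw.2.1
  -- Every long element of a cone contains a loop that belongs to `W`.
  have hloop : ∀ x c : Γ, InCone S x c → N ≤ wordLength S c → ∃ c₁ w c₂ : Γ,
      c = c₁ * w * c₂ ∧ wordLength S c = wordLength S c₁ + wordLength S w + wordLength S c₂ ∧
      InCone S x c₁ ∧ InCone S (x * c₁) w ∧ InCone S (x * c₁ * w) c₂ ∧
      ConeEquiv S T (x * c₁) (x * c₁ * w) ∧ w ∈ W := by
    intro x c hxc hc
    obtain ⟨c₁, w, c₂, rfl, hlen, hw0, hwN, he⟩ := hN x c hxc hc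
    have e1 := wordLength_mul_le hS (c₁ * w) c₂
    have e2 := wordLength_mul_le hS c₁ w
    obtain ⟨h1, h2⟩ := (inCone_mul_iff hS (by omega)).1 hxc
    obtain ⟨h3, h4⟩ := (inCone_mul_iff hS (by omega)).1 h1
    rw [← mul_assoc] at h2
    exact ⟨c₁, w, c₂, rfl, hlen, h3, h4, h2, he, hw0, hwN, _, h4, he⟩
  have hWne : W.Nonempty := by
    obtain ⟨c, hc⟩ := (finite_wordLength_le hS hSfin N).infinite_compl.nonempty
    have hc' : N ≤ wordLength S c := by
      simp only [Set.mem_compl_iff, Set.mem_ofPred_eq] at hc; omega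
    obtain ⟨_, w, _, -, -, -, -, -, -, hw⟩ := hloop 1 c (by simp [InCone, wordLength_one]) hc'
    exact ⟨w, hw⟩
  obtain ⟨w, hwW, hmax⟩ := Set.exists_max_image W
    (fun w => translationLength T w / translationLength S w) hWfin hWne
  have hpos : ∀ v ∈ W, 0 < translationLength S v := by
    rintro v ⟨h0, -, x, hx, hx'⟩
    rw [(translationLength_of_loop hS hT hx hx').1]
    exact_mod_cast h0
  refine ⟨w, hpos w hwW, ?_⟩
  set r := translationLength T w / translationLength S w with hr
  have hr0 : 0 ≤ r := div_nonneg (translationLength_nonneg hT _) (translationLength_nonneg hS _)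
  have key : ∀ (n : ℕ) (x c : Γ), wordLength S c = n → InCone S x c →
      (wordLength T (x * c) : ℝ) - wordLength T x ≤ r * wordLength S c + A * N := by
    intro n
    induction n using Nat.strong_induction_on with
    | _ n ih =>
      intro x c hcn hxc
      rcases lt_or_ge (wordLength S c) N with hlt | hge
      · have h1 := wordLength_mul_le hT x c
        have h2 : wordLength T c ≤ A * N :=
          (hA c).trans (Nat.mul_le_mul_left _ hlt.le)
        have h3 : (wordLength T (x * c) : ℝ) ≤ wordLength T x + A * N := by
          exact_mod_cast h1.trans (by omega)
        have h4 : 0 ≤ r * wordLength S c := by positivity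
        linarith
      · obtain ⟨c₁, v, c₂, rfl, hlen, h1, h2, h3, he, hv⟩ := hloop x c hxc hge
        have h4 := (he.1 c₂).2 h3
        obtain ⟨h5, h6⟩ := h1.mul hS h4
        have h7 := ih (wordLength S (c₁ * c₂)) (by have := hv.1; omega) x (c₁ * c₂) rfl h5
        have h8 := he.2 c₂ h4
        obtain ⟨h9, h10⟩ := translationLength_of_loop hS hT h2 he
        have h11 : translationLength T v ≤ r * translationLength S v := by
          have := hmax v hv
          rwa [div_le_iff₀ (hpos v hv)] at this
        rw [h9, h10] at h11
        have h12 : (wordLength T (x * c₁ * c₂) : ℝ) - wordLength T (x * c₁) =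
            wordLength T (x * c₁ * v * c₂) - wordLength T (x * c₁ * v) := by exact_mod_cast h8
        rw [hlen]
        rw [h6] at h7
        push_cast at h7 ⊢
        simp only [← mul_assoc] at h7 ⊢
        linarith
  intro g
  refine translationLength_le_mul hS hT (C := A * N) fun n => ?_
  have := key _ 1 (g ^ n) rfl (by simp [InCone, wordLength_one])
  simpa [wordLength_one] using this

/-- An element with the maximal ratio realises the dilation. -/
theorem dilation_eq_of_forall {S T : Set Γ} (hS : Subgroup.closure S = ⊤)
    (hT : Subgroup.closure T = ⊤) {w : Γ} (hw : 0 < translationLength S w)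
    (h : ∀ g : Γ, translationLength T g ≤ translationLength T w / translationLength S w *
      translationLength S g) :
    dilation T S = translationLength T w / translationLength S w := by
  refine IsGreatest.csSup_eq ⟨⟨w, not_isOfFinOrder_of_translationLength_pos hS hw, rfl⟩, ?_⟩
  rintro _ ⟨g, -, rfl⟩
  rcases (translationLength_nonneg hS g).eq_or_lt with h0 | h0
  · rw [← h0, div_zero]
    exact div_nonneg (translationLength_nonneg hT _) (translationLength_nonneg hS _)
  · rw [div_le_iff₀ h0]
    exact h g

/-! ### Quasi-geodesic words in long letters -/

section Letters

variable {S₀ : Set Γ} {δ : ℝ}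

theorem gromovProd_one_self_mul (hδ : IsHyperbolicDist (realDist S₀) δ) (l v : Γ) :
    gromovProd (realDist S₀) 1 l (l * v) =
      wordLength S₀ l - gromovProd (realDist S₀) 1 l⁻¹ v := by
  have h1 := realDist_mul_left S₀ l l⁻¹ v
  have h2 := realDist_mul_left S₀ l 1 v
  have h3 := realDist_mul_left S₀ l l⁻¹ 1
  rw [mul_inv_cancel] at h1 h3
  rw [mul_one] at h2 h3
  rw [← realDist_one_left]
  simp only [gromovProd]
  rw [h2, ← h1, ← h3, hδ.symm l 1, hδ.symm (l * v) 1, hδ.symm v 1]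
  ring

theorem gromovProd_one_le_wordLength (hδ : IsHyperbolicDist (realDist S₀) δ) (x b : Γ) :
    gromovProd (realDist S₀) 1 x b ≤ wordLength S₀ b := by
  have h1 := hδ.triangle x b 1
  rw [← realDist_one_left, hδ.symm 1 b]
  simp only [gromovProd]
  linarith

variable {Λ : Set Γ} {K R : ℝ}

theorem gromovProd_letter_word_le (hδ : IsHyperbolicDist (realDist S₀) δ) (hK0 : 0 ≤ K)
    (hK : ∀ l ∈ Λ, ∀ l' ∈ Λ, gromovProd (realDist S₀) 1 l⁻¹ l' ≤ K)
    (hlong : ∀ l ∈ Λ, 2 * K + 4 * δ < wordLength S₀ l) {l v : Γ} (hl : l ∈ Λ)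
    (hv : v ∈ Submonoid.closure Λ) : gromovProd (realDist S₀) 1 l⁻¹ v ≤ K + δ := by
  have hδ1 := hδ.one_le
  induction hv using Submonoid.closure_induction_left generalizing l with
  | one =>
    have := gromovProd_one_le_wordLength hδ l⁻¹ 1
    rw [wordLength_one] at this
    push_cast at this
    linarith
  | mul_left x hx y hy ih =>
    refine hδ.gromovProd_le (hK l hl x hx) ?_
    rw [gromovProd_one_self_mul hδ]
    linarith [ih hx, hlong x hx]

theorem gromovProd_word_letter_le (hδ : IsHyperbolicDist (realDist S₀) δ) (hK0 : 0 ≤ K)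
    (hK : ∀ l ∈ Λ, ∀ l' ∈ Λ, gromovProd (realDist S₀) 1 l⁻¹ l' ≤ K)
    (hlong : ∀ l ∈ Λ, 2 * K + 4 * δ < wordLength S₀ l) (hS₀ : Subgroup.closure S₀ = ⊤)
    {l u : Γ} (hl : l ∈ Λ)
    (hu : u ∈ Submonoid.closure Λ) : gromovProd (realDist S₀) 1 u⁻¹ l ≤ K + δ := by
  have hδ1 := hδ.one_le
  induction hu using Submonoid.closure_induction_right generalizing l with
  | one =>
    have := gromovProd_one_le_wordLength hδ l 1⁻¹
    rw [hδ.gromovProd_comm, inv_one, wordLength_one] at this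
    push_cast at this
    rw [inv_one]
    linarith
  | mul_right x hx y hy ih =>
    rw [hδ.gromovProd_comm]
    have h1 := hK y hy l hl
    rw [hδ.gromovProd_comm] at h1
    refine hδ.gromovProd_le h1 ?_
    rw [mul_inv_rev, gromovProd_one_self_mul hδ, inv_inv, wordLength_inv hS₀,
      hδ.gromovProd_comm]
    linarith [ih hy, hlong y hy]

/-- Local-to-global principle: if the letters are long compared with the Gromov products at the
junctions, all Gromov products along words in these letters are bounded. -/
theorem gromovProd_word_word_le (hδ : IsHyperbolicDist (realDist S₀) δ) (hK0 : 0 ≤ K)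
    (hK : ∀ l ∈ Λ, ∀ l' ∈ Λ, gromovProd (realDist S₀) 1 l⁻¹ l' ≤ K)
    (hlong : ∀ l ∈ Λ, 2 * K + 4 * δ < wordLength S₀ l) (hS₀ : Subgroup.closure S₀ = ⊤)
    {u v : Γ} (hu : u ∈ Submonoid.closure Λ) (hv : v ∈ Submonoid.closure Λ) :
    gromovProd (realDist S₀) 1 u⁻¹ v ≤ K + δ + δ := by
  have hδ1 := hδ.one_le
  induction hv using Submonoid.closure_induction_left with
  | one =>
    have := gromovProd_one_le_wordLength hδ u⁻¹ 1
    rw [wordLength_one] at this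
    push_cast at this
    linarith
  | mul_left x hx y hy _ =>
    refine hδ.gromovProd_le (gromovProd_word_letter_le hδ hK0 hK hlong hS₀ hx hu) ?_
    rw [gromovProd_one_self_mul hδ]
    linarith [gromovProd_letter_word_le hδ hK0 hK hlong hx hy, hlong x hx]

/-- Changing a word within a bounded distance of its end does not affect the bound. -/
theorem gromovProd_word_letter_mul_le (hδ : IsHyperbolicDist (realDist S₀) δ) (hK0 : 0 ≤ K)
    (hK : ∀ l ∈ Λ, ∀ l' ∈ Λ, gromovProd (realDist S₀) 1 l⁻¹ l' ≤ K)
    (hlong : ∀ l ∈ Λ, 2 * K + 4 * δ + R < wordLength S₀ l) (hR : 0 ≤ R)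
    (hS₀ : Subgroup.closure S₀ = ⊤) {u l b : Γ} (hu : u ∈ Submonoid.closure Λ) (hl : l ∈ Λ)
    (hb : wordLength S₀ b ≤ R) : gromovProd (realDist S₀) 1 u⁻¹ (l * b) ≤ K + δ + δ := by
  have hδ1 := hδ.one_le
  have hlong' : ∀ l ∈ Λ, 2 * K + 4 * δ < wordLength S₀ l := fun l hl => by
    linarith [hlong l hl]
  refine hδ.gromovProd_le (gromovProd_word_letter_le hδ hK0 hK hlong' hS₀ hl hu) ?_
  rw [gromovProd_one_self_mul hδ]
  linarith [gromovProd_one_le_wordLength hδ l⁻¹ b, hlong l hl]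

end Letters

/-! ### Pumping -/

/-- Some `S`-geodesic from `1` to a word in the letters `Λ`, or to an element within `R` of such a
word, passes within `R` of each prefix `u` of the word. For the nearby elements only the prefixes
missing the last letter are needed. -/
structure IsGuided (S₀ S : Set Γ) (R : ℕ) (Λ : Set Γ) : Prop where
  word : ∀ u ∈ Submonoid.closure Λ, ∀ v ∈ Submonoid.closure Λ, PassesNear S₀ S R u v
  near : ∀ u ∈ Submonoid.closure Λ, ∀ l ∈ Λ, ∀ b, wordLength S₀ b ≤ R →
    PassesNear S₀ S R u (l * b)

/-- Types along words in the letters `Λ` evolve deterministically. -/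
theorem IsGuided.localType_mul_eq {S₀ S Λ : Set Γ} {R : ℕ} (hΛ : IsGuided S₀ S R Λ)
    (hS : Subgroup.closure S = ⊤) {u u' c : Γ} (hu : u ∈ Submonoid.closure Λ)
    (hu' : u' ∈ Submonoid.closure Λ) (hc : c ∈ Submonoid.closure Λ)
    (h : localType S₀ S R u = localType S₀ S R u') :
    localType S₀ S R (u * c) = localType S₀ S R (u' * c) := by
  induction hc using Submonoid.closure_induction_right with
  | one => simpa using h
  | mul_right x hx l hl ih =>
    funext b
    have hux := mul_mem hu hx
    have hux' := mul_mem hu' hx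
    have hl' := Submonoid.subset_closure hl
    have h1 := wordLength_sub_eq_of_localType_eq hS ih (hΛ.near _ hux l hl b b.2)
      (hΛ.near _ hux' l hl b b.2)
    have h2 := wordLength_sub_eq_of_localType_eq hS ih (hΛ.word _ hux l hl')
      (hΛ.word _ hux' l hl')
    simp only [localType, ← mul_assoc] at h1 h2 ⊢
    linarith

/-- Once a letter block is long, lengthening it by a fixed period adds exactly the corresponding
multiple of the stable translation length. -/
theorem IsGuided.exists_wordLength_pump {S₀ S Λ : Set Γ} {R : ℕ} (hΛ : IsGuided S₀ S R Λ)
    (hS₀ : Subgroup.closure S₀ = ⊤) (hS : Subgroup.closure S = ⊤) (hfin₀ : S₀.Finite) :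
    ∃ M : ℕ, ∀ M' ≥ M, ∀ u ∈ Submonoid.closure Λ, ∀ c ∈ Submonoid.closure Λ,
      ∀ v ∈ Submonoid.closure Λ, ∀ i ≥ M',
      (wordLength S (u * c ^ (i + M'.factorial) * v) : ℝ) =
        wordLength S (u * c ^ i * v) + M'.factorial * translationLength S c := by
  obtain ⟨M, hM⟩ := exists_repeat_of_finite_range (finite_range_localType hS₀ hS hfin₀ R)
  refine ⟨M, fun M' hM' u hu c hc v hv i hi => ?_⟩
  obtain ⟨i₀, j₀, hij, hj, he⟩ := hM fun i => u * c ^ i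
  have hmem : ∀ k, u * c ^ k ∈ Submonoid.closure Λ := fun k => mul_mem hu (pow_mem hc k)
  have hper : ∀ k ≥ i₀, localType S₀ S R (u * c ^ (k + (j₀ - i₀))) =
      localType S₀ S R (u * c ^ k) := by
    intro k hk
    have := hΛ.localType_mul_eq hS (hmem i₀) (hmem j₀) (pow_mem hc (k - i₀)) he
    rw [mul_assoc, mul_assoc, ← pow_add, ← pow_add] at this
    rw [show k + (j₀ - i₀) = j₀ + (k - i₀) by omega, ← this,
      show i₀ + (k - i₀) = k by omega]
  have hper' : ∀ n k, k ≥ i₀ → localType S₀ S R (u * c ^ (k + n * (j₀ - i₀))) =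
      localType S₀ S R (u * c ^ k) := by
    intro n
    induction n with
    | zero => simp
    | succ n ih =>
      intro k hk
      rw [show k + (n + 1) * (j₀ - i₀) = (k + n * (j₀ - i₀)) + (j₀ - i₀) by ring,
        hper _ (by omega), ih k hk]
  obtain ⟨p, hp⟩ := Nat.dvd_factorial (show 0 < j₀ - i₀ by omega) (show j₀ - i₀ ≤ M' by omega)
  set N := M'.factorial with hN
  have hperN : ∀ n, localType S₀ S R (u * c ^ (i + n * N)) = localType S₀ S R (u * c ^ i) := by
    intro n
    rw [hp, show i + n * ((j₀ - i₀) * p) = i + (n * p) * (j₀ - i₀) by ring]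
    exact hper' _ _ (by omega)
  have hgrow : ∀ n : ℕ, (wordLength S (u * c ^ i * (c ^ N) ^ n) : ℝ) =
      n * ((wordLength S (u * c ^ (i + N)) : ℝ) - wordLength S (u * c ^ i)) +
        wordLength S (u * c ^ i) := by
    intro n
    induction n with
    | zero => simp
    | succ n ih =>
      have h1 := wordLength_sub_eq_of_localType_eq hS (hperN n)
        (hΛ.word _ (hmem _) _ (pow_mem hc N)) (hΛ.word _ (hmem _) _ (pow_mem hc N))
      have h2 : u * c ^ i * (c ^ N) ^ (n + 1) = u * c ^ (i + n * N) * c ^ N := by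
        rw [← pow_mul, mul_assoc, mul_assoc, ← pow_add, ← pow_add]; congr 2; ring
      have h3 : u * c ^ i * (c ^ N) ^ n = u * c ^ (i + n * N) := by
        rw [← pow_mul, mul_assoc, ← pow_add]; congr 2; ring
      have h4 : u * c ^ i * c ^ N = u * c ^ (i + N) := by rw [mul_assoc, ← pow_add]
      rw [h3] at ih
      rw [h2]
      rw [h4] at h1
      have h1' : (wordLength S (u * c ^ (i + n * N) * c ^ N) : ℝ) -
          wordLength S (u * c ^ (i + n * N)) =
          wordLength S (u * c ^ (i + N)) - wordLength S (u * c ^ i) := by exact_mod_cast h1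
      push_cast
      linarith
  have h1 := translationLength_eq_of_forall hS _ hgrow
  rw [translationLength_pow hS] at h1
  have h2 := hperN 1
  rw [one_mul] at h2
  have h3 := wordLength_sub_eq_of_localType_eq hS h2 (hΛ.word _ (hmem _) v hv)
    (hΛ.word _ (hmem _) v hv)
  have h4 : (wordLength S (u * c ^ (i + N) * v) : ℝ) - wordLength S (u * c ^ (i + N)) =
      wordLength S (u * c ^ i * v) - wordLength S (u * c ^ i) := by exact_mod_cast h3
  linarith

/-- Pumping for lengths gives pumping for stable translation lengths: in a power of the longer word
the blocks can be shortened one at a time. -/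
theorem translationLength_pump {S : Set Γ} (hS : Subgroup.closure S = ⊤) {W : Submonoid Γ}
    {M N : ℕ} {c : Γ} (hc : c ∈ W)
    (h : ∀ u ∈ W, ∀ v ∈ W, ∀ i ≥ M,
      (wordLength S (u * c ^ (i + N) * v) : ℝ) =
        wordLength S (u * c ^ i * v) + N * translationLength S c)
    {u v : Γ} (hu : u ∈ W) (hv : v ∈ W) {i : ℕ} (hi : i ≥ M) :
    translationLength S (u * c ^ (i + N) * v) =
      translationLength S (u * c ^ i * v) + N * translationLength S c := by
  have hP : u * c ^ (i + N) * v ∈ W := mul_mem (mul_mem hu (pow_mem hc _)) hv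
  have hQ : u * c ^ i * v ∈ W := mul_mem (mul_mem hu (pow_mem hc _)) hv
  have key : ∀ j m : ℕ,
      (wordLength S ((u * c ^ (i + N) * v) ^ j * (u * c ^ i * v) ^ m) : ℝ) =
        wordLength S ((u * c ^ i * v) ^ (j + m)) + j * (N * translationLength S c) := by
    intro j
    induction j with
    | zero => simp
    | succ j ih =>
      intro m
      have h1 := h _ (mul_mem (pow_mem hP j) hu) _ (mul_mem hv (pow_mem hQ m)) i hi
      have h2 : (u * c ^ (i + N) * v) ^ (j + 1) * (u * c ^ i * v) ^ m =
          (u * c ^ (i + N) * v) ^ j * u * c ^ (i + N) * (v * (u * c ^ i * v) ^ m) := by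
        rw [pow_succ]; simp only [mul_assoc]
      have h3 : (u * c ^ (i + N) * v) ^ j * u * c ^ i * (v * (u * c ^ i * v) ^ m) =
          (u * c ^ (i + N) * v) ^ j * (u * c ^ i * v) ^ (m + 1) := by
        rw [pow_succ' _ m]; simp only [mul_assoc]
      rw [h2, h1, h3, ih (m + 1), show j + (m + 1) = j + 1 + m by ring]
      push_cast; ring
  refine tendsto_nhds_unique (tendsto_wordLength_pow_div hS _) ?_
  refine ((tendsto_wordLength_pow_div hS (u * c ^ i * v)).add_const
    (N * translationLength S c)).congr' ?_
  filter_upwards [eventually_gt_atTop 0] with j hj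
  have h1 := key j 0
  rw [pow_zero, mul_one, add_zero] at h1
  have : (j : ℝ) ≠ 0 := by positivity
  rw [h1]
  field_simp

/-! ### Independent elements -/

theorem translationLength_zpow {S : Set Γ} (hS : Subgroup.closure S = ⊤) (g : Γ) (n : ℤ) :
    translationLength S (g ^ n) = n.natAbs * translationLength S g := by
  rcases Int.natAbs_eq n with h | h
  · conv_lhs => rw [h]
    rw [zpow_natCast, translationLength_pow hS]
  · conv_lhs => rw [h]
    rw [zpow_neg, zpow_natCast, translationLength_inv hS, translationLength_pow hS]

theorem mul_translationLength_le_wordLength_pow {S : Set Γ} (hS : Subgroup.closure S = ⊤)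
    (g : Γ) (n : ℕ) : n * translationLength S g ≤ wordLength S (g ^ n) := by
  rw [← translationLength_pow hS]
  exact translationLength_le hS _

/-- Powers of an element of positive stable translation length form a quasi-geodesic. -/
theorem exists_quasiGeodesic_pow {S : Set Γ} (hS : Subgroup.closure S = ⊤) {g : Γ}
    (hg : 0 < translationLength S g) :
    ∃ c : ℝ, 1 ≤ c ∧ ∀ n, QuasiGeodesic (realDist S) c n fun k => g ^ k := by
  refine ⟨max 1 (max (translationLength S g)⁻¹ (wordLength S g)), le_max_left _ _,
    fun n i j hij hj => ?_⟩
  have h1 : realDist S (g ^ i) (g ^ j) = wordLength S (g ^ (j - i)) := by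
    rw [← realDist_one_left, ← realDist_mul_left S (g ^ i) 1, mul_one, ← pow_add,
      Nat.add_sub_cancel' hij]
  rw [h1, ← Nat.cast_sub hij]
  constructor
  · have h2 := mul_translationLength_le_wordLength_pow hS g (j - i)
    calc ((j - i : ℕ) : ℝ) = (translationLength S g)⁻¹ * ((j - i : ℕ) * translationLength S g) := by
          field_simp
      _ ≤ (translationLength S g)⁻¹ * wordLength S (g ^ (j - i)) := by gcongr
      _ ≤ _ := by gcongr; exact (le_max_left _ _).trans (le_max_right _ _)
  · have h2 := wordLength_pow_le hS g (j - i)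
    calc (wordLength S (g ^ (j - i)) : ℝ) ≤ (j - i : ℕ) * wordLength S g := by exact_mod_cast h2
      _ = wordLength S g * (j - i : ℕ) := mul_comm _ _
      _ ≤ _ := by gcongr; exact (le_max_right _ _).trans (le_max_right _ _)

theorem exists_gromovProd_pow_pow_self_le {S₀ : Set Γ} (hS₀ : Subgroup.closure S₀ = ⊤) {δ : ℝ}
    (hδ : IsHyperbolicDist (realDist S₀) δ) {a : Γ} (ha : 0 < translationLength S₀ a) :
    ∃ K : ℝ, 0 ≤ K ∧ ∀ i j : ℕ, gromovProd (realDist S₀) 1 (a ^ i)⁻¹ (a ^ j) ≤ K := by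
  obtain ⟨c, hc, hq⟩ := exists_quasiGeodesic_pow hS₀ ha
  obtain ⟨K, hK0, hK⟩ := hδ.gromovProd_quasiGeodesic_le (exists_realDist_geodesic hS₀) hc
  refine ⟨K, hK0, fun i j => ?_⟩
  have h1 := hK (i + j) _ (hq _) i (by omega)
  rw [← gromovProd_mul_left S₀ (a ^ i)⁻¹] at h1
  simpa [pow_add] using h1

/-- If no nontrivial power of `a` is a power of `b`, the ray of negative powers of `a` and the ray
of positive powers of `b` diverge. Otherwise they would fellow-travel for a long time, and two of
the finitely many possible displacements between them would coincide. -/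
theorem exists_gromovProd_pow_pow_le {S₀ : Set Γ} (hS₀ : Subgroup.closure S₀ = ⊤)
    (hfin₀ : S₀.Finite) {δ : ℝ} (hδ : IsHyperbolicDist (realDist S₀) δ) {a b : Γ}
    (ha : 0 < translationLength S₀ a) (hb : 0 < translationLength S₀ b)
    (hab : ∀ (m : ℕ) (n : ℤ), 0 < m → a ^ m ≠ b ^ n) :
    ∃ K : ℝ, 0 ≤ K ∧ ∀ i j : ℕ, gromovProd (realDist S₀) 1 (a ^ i)⁻¹ (b ^ j) ≤ K := by
  obtain ⟨Ka, hKa0, hKa⟩ := exists_gromovProd_pow_pow_self_le hS₀ hδ ha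
  obtain ⟨c, hc, hq⟩ := exists_quasiGeodesic_pow hS₀ hb
  obtain ⟨R, hR⟩ := hδ.exists_near_quasiGeodesic (exists_realDist_geodesic hS₀) hc (Ka + δ)
  have hδ1 := hδ.one_le
  set B := (finite_wordLength_le hS₀ hfin₀ ⌊R⌋₊).toFinset with hB
  refine ⟨B.card * wordLength S₀ a + Ka + 2 * δ, by positivity, fun i j => ?_⟩
  by_contra hcon
  push Not at hcon
  have hi : B.card ≤ i := by
    by_contra hlt
    push Not at hlt
    have h1 := gromovProd_one_le_wordLength hδ (b ^ j) (a ^ i)⁻¹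
    rw [hδ.gromovProd_comm, wordLength_inv hS₀] at h1
    have h2 : (wordLength S₀ (a ^ i) : ℝ) ≤ B.card * wordLength S₀ a := by
      exact_mod_cast (wordLength_pow_le hS₀ a i).trans (Nat.mul_le_mul_right _ hlt.le)
    linarith
  have hnear : ∀ k : ℕ, k ≤ B.card → ∃ m : ℕ, a ^ k * b ^ m ∈ B := by
    intro k hk
    have h1 : gromovProd (realDist S₀) (a ^ k)⁻¹ 1 (a ^ i)⁻¹ ≤ Ka := by
      have h2 := hKa (i - k) k
      rw [hδ.gromovProd_comm, ← gromovProd_mul_left S₀ (a ^ k)⁻¹] at h2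
      rw [mul_one, inv_mul_cancel, ← mul_inv_rev, ← pow_add, Nat.sub_add_cancel (hk.trans hi)] at h2
      exact h2
    have h3 : Ka + δ < gromovProd (realDist S₀) (a ^ k)⁻¹ (a ^ i)⁻¹ (b ^ j) := by
      have e1 := hδ.triangle (a ^ i)⁻¹ (a ^ k)⁻¹ 1
      have e2 := hδ.triangle (b ^ j) (a ^ k)⁻¹ 1
      have e3 : realDist S₀ (a ^ k)⁻¹ 1 ≤ B.card * wordLength S₀ a := by
        rw [hδ.symm, realDist_one_left, wordLength_inv hS₀]
        exact_mod_cast (wordLength_pow_le hS₀ a k).trans (Nat.mul_le_mul_right _ hk)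
      simp only [gromovProd] at hcon ⊢
      linarith
    have h4 := hδ.gromovProd_le h1 h3
    obtain ⟨m, -, hm⟩ := hR j _ (hq j) (a ^ k)⁻¹ (by simpa using h4)
    refine ⟨m, ?_⟩
    rw [hB, Set.Finite.mem_toFinset]
    refine Nat.le_floor ?_
    simpa [realDist, wordDist] using hm
  choose! m hm using hnear
  obtain ⟨k, hk, k', hk', hkk', he⟩ := Finset.exists_ne_map_eq_of_card_lt_of_maps_to
    (s := Finset.range (B.card + 1)) (t := B) (f := fun k => a ^ k * b ^ m k) (by simp)
    (fun k hk => hm k (by simpa [Nat.lt_succ_iff] using hk))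
  have key : ∀ k k' : ℕ, k < k' → a ^ k * b ^ m k = a ^ k' * b ^ m k' → False := by
    intro k k' hlt he
    refine hab (k' - k) ((m k : ℤ) - m k') (by omega) ?_
    have hpow : a ^ k' = a ^ k * a ^ (k' - k) := by rw [← pow_add, Nat.add_sub_cancel' hlt.le]
    rw [hpow, mul_assoc, mul_right_inj] at he
    rw [zpow_sub, zpow_natCast, zpow_natCast, he, mul_inv_cancel_right]
  rcases lt_or_gt_of_ne hkk' with hlt | hlt
  · exact key k k' hlt he
  · exact key k' k hlt he.symm

/-- Elements with different ratios of stable translation lengths have no common powers. -/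
theorem pow_ne_zpow_of_ratio_ne {S T : Set Γ} (hS : Subgroup.closure S = ⊤)
    (hT : Subgroup.closure T = ⊤) {a b : Γ}
    (hab : translationLength S a * translationLength T b ≠
      translationLength T a * translationLength S b) (m : ℕ) (n : ℤ) (hm : 0 < m) :
    a ^ m ≠ b ^ n := by
  intro he
  have h1 := congrArg (translationLength S) he
  have h2 := congrArg (translationLength T) he
  rw [translationLength_pow hS, translationLength_zpow hS] at h1
  rw [translationLength_pow hT, translationLength_zpow hT] at h2
  have hm' : (m : ℝ) ≠ 0 := by positivity
  refine hab (mul_left_cancel₀ hm' ?_)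
  linear_combination translationLength T b * h1 - translationLength S b * h2

/-- Large powers of two elements without common powers are the letters of guided words. -/
theorem exists_isGuided {S₀ S T : Set Γ} (hS₀ : Subgroup.closure S₀ = ⊤)
    (hS : Subgroup.closure S = ⊤) (hT : Subgroup.closure T = ⊤) (hfin₀ : S₀.Finite)
    (hSfin : S.Finite) (hTfin : T.Finite) {δ : ℝ} (hδ : IsHyperbolicDist (realDist S₀) δ)
    {a b : Γ} (ha : 0 < translationLength S₀ a) (hb : 0 < translationLength S₀ b)
    (hab : ∀ (m : ℕ) (n : ℤ), 0 < m → a ^ m ≠ b ^ n)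
    (hba : ∀ (m : ℕ) (n : ℤ), 0 < m → b ^ m ≠ a ^ n) :
    ∃ J R : ℕ, 0 < J ∧ IsGuided S₀ S R {a ^ J, b ^ J} ∧ IsGuided S₀ T R {a ^ J, b ^ J} := by
  obtain ⟨K₁, h₁, hK₁⟩ := exists_gromovProd_pow_pow_self_le hS₀ hδ ha
  obtain ⟨K₂, h₂, hK₂⟩ := exists_gromovProd_pow_pow_self_le hS₀ hδ hb
  obtain ⟨K₃, h₃, hK₃⟩ := exists_gromovProd_pow_pow_le hS₀ hfin₀ hδ ha hb hab
  obtain ⟨K₄, h₄, hK₄⟩ := exists_gromovProd_pow_pow_le hS₀ hfin₀ hδ hb ha hba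
  have hδ1 := hδ.one_le
  set K := K₁ + K₂ + K₃ + K₄ with hKdef
  have hK0 : 0 ≤ K := by positivity
  obtain ⟨R₁, hR₁⟩ := exists_passesNear hS₀ hS hfin₀ hSfin hδ (K + δ + δ)
  obtain ⟨R₂, hR₂⟩ := exists_passesNear hS₀ hT hfin₀ hTfin hδ (K + δ + δ)
  set R := max R₁ R₂
  have hmin : 0 < min (translationLength S₀ a) (translationLength S₀ b) := lt_min ha hb
  obtain ⟨J, hJ⟩ := exists_nat_gt ((2 * K + 4 * δ + R) /
    min (translationLength S₀ a) (translationLength S₀ b))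
  rw [div_lt_iff₀ hmin] at hJ
  have hJ0 : 0 < J := by
    rcases Nat.eq_zero_or_pos J with rfl | h
    · have : (0 : ℝ) ≤ R := Nat.cast_nonneg _
      norm_num at hJ
      linarith
    · exact h
  have hjunction : ∀ l ∈ ({a ^ J, b ^ J} : Set Γ), ∀ l' ∈ ({a ^ J, b ^ J} : Set Γ),
      gromovProd (realDist S₀) 1 l⁻¹ l' ≤ K := by
    rintro l (rfl | rfl) l' (rfl | rfl)
    · linarith [hK₁ J J]
    · linarith [hK₃ J J]
    · linarith [hK₄ J J]
    · linarith [hK₂ J J]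
  have hlong : ∀ l ∈ ({a ^ J, b ^ J} : Set Γ), 2 * K + 4 * δ + R < wordLength S₀ l := by
    rintro l (rfl | rfl)
    · refine (hJ.trans_le ?_).trans_le (mul_translationLength_le_wordLength_pow hS₀ a J)
      gcongr; exact min_le_left _ _
    · refine (hJ.trans_le ?_).trans_le (mul_translationLength_le_wordLength_pow hS₀ b J)
      gcongr; exact min_le_right _ _
  have hlong' : ∀ l ∈ ({a ^ J, b ^ J} : Set Γ), 2 * K + 4 * δ < wordLength S₀ l := fun l hl => by
    have : (0 : ℝ) ≤ R := Nat.cast_nonneg _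
    linarith [hlong l hl]
  have hword : ∀ u ∈ Submonoid.closure ({a ^ J, b ^ J} : Set Γ),
      ∀ v ∈ Submonoid.closure ({a ^ J, b ^ J} : Set Γ),
      gromovProd (realDist S₀) 1 u⁻¹ v ≤ K + δ + δ := fun u hu v hv =>
    gromovProd_word_word_le hδ hK0 hjunction hlong' hS₀ hu hv
  have hnear : ∀ u ∈ Submonoid.closure ({a ^ J, b ^ J} : Set Γ), ∀ l ∈ ({a ^ J, b ^ J} : Set Γ),
      ∀ c, wordLength S₀ c ≤ R → gromovProd (realDist S₀) 1 u⁻¹ (l * c) ≤ K + δ + δ :=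
    fun u hu l hl c hc => gromovProd_word_letter_mul_le hδ hK0 hjunction hlong
      (Nat.cast_nonneg _) hS₀ hu hl (by exact_mod_cast hc)
  exact ⟨J, R, hJ0,
    ⟨fun u hu v hv => (hR₁ _ _ (hword u hu v hv)).mono (le_max_left _ _),
      fun u hu l hl c hc => (hR₁ _ _ (hnear u hu l hl c hc)).mono (le_max_left _ _)⟩,
    ⟨fun u hu v hv => (hR₂ _ _ (hword u hu v hv)).mono (le_max_right _ _),
      fun u hu l hl c hc => (hR₂ _ _ (hnear u hu l hl c hc)).mono (le_max_right _ _)⟩⟩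

/-! ### Elements with prescribed rational ratio -/

theorem translationLength_family {S : Set Γ} (hS : Subgroup.closure S = ⊤) {W : Submonoid Γ}
    {M N : ℕ}
    (h : ∀ u ∈ W, ∀ c ∈ W, ∀ v ∈ W, ∀ i ≥ M,
      (wordLength S (u * c ^ (i + N) * v) : ℝ) =
        wordLength S (u * c ^ i * v) + N * translationLength S c)
    {A B : Γ} (hA : A ∈ W) (hB : B ∈ W) (k s t : ℕ) :
    translationLength S (A ^ (M + s * N) * B ^ (M + t * N) * (A ^ M * B ^ M) ^ k) =
      (k + 1) * translationLength S (A ^ M * B ^ M) + s * (N * translationLength S A) +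
        t * (N * translationLength S B) := by
  have hU : A ^ M * B ^ M ∈ W := mul_mem (pow_mem hA _) (pow_mem hB _)
  induction s with
  | zero =>
    induction t with
    | zero =>
      simp only [zero_mul, add_zero, ← pow_succ', translationLength_pow hS]
      push_cast; ring
    | succ t ih =>
      have h1 := translationLength_pump hS hB (fun u hu v hv => h u hu B hB v hv)
        (pow_mem hA (M + 0 * N)) (pow_mem hU k) (i := M + t * N) (by omega)
      rw [show M + (t + 1) * N = M + t * N + N by ring, h1, ih]
      push_cast; ring
  | succ s ih =>
    have h1 := translationLength_pump hS hA (fun u hu v hv => h u hu A hA v hv)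
      (one_mem W) (mul_mem (pow_mem hB (M + t * N)) (pow_mem hU k)) (i := M + s * N) (by omega)
    simp only [one_mul, ← mul_assoc] at h1
    rw [show M + (s + 1) * N = M + s * N + N by ring, h1, ih]
    push_cast; ring

/-- The pairs of lengths `(ℓ_S, ℓ_T)` of the elements
`A ^ (M + s N) * B ^ (M + t N) * (A ^ M * B ^ M) ^ k`, for suitable powers `A`, `B` of `a`, `b`, are
integral up to a fixed factor and affine in `(k, s, t)`. -/
theorem exists_affine_family {S₀ S T : Set Γ} (hS₀ : Subgroup.closure S₀ = ⊤)
    (hS : Subgroup.closure S = ⊤) (hT : Subgroup.closure T = ⊤) (hfin₀ : S₀.Finite)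
    (hSfin : S.Finite) (hTfin : T.Finite) {δ : ℝ} (hδ : IsHyperbolicDist (realDist S₀) δ)
    {a b : Γ} (ha : 0 < translationLength S a) (hb : 0 < translationLength S b)
    (hab : translationLength S a * translationLength T b ≠
      translationLength T a * translationLength S b) :
    ∃ (g : ℕ → ℕ → ℕ → Γ) (N P : ℕ) (α₁ α₂ β₁ β₂ μ₁ μ₂ : ℤ), 0 < N ∧ 0 < P ∧
      (α₁ : ℝ) = P * translationLength S a ∧ (α₂ : ℝ) = P * translationLength T a ∧
      (β₁ : ℝ) = P * translationLength S b ∧ (β₂ : ℝ) = P * translationLength T b ∧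
      (∀ k s t : ℕ, N * translationLength S (g k s t) =
        (((k + 1) * μ₁ + s * α₁ + t * β₁ : ℤ) : ℝ)) ∧
      (∀ k s t : ℕ, N * translationLength T (g k s t) =
        (((k + 1) * μ₂ + s * α₂ + t * β₂ : ℤ) : ℝ)) ∧
      ∀ k : ℕ, ∃ L : ℝ, 0 < L ∧ ∀ s t : ℕ, (wordLength S (g k s t) : ℝ) ≤ L * (1 + s + t) := by
  obtain ⟨J, R, hJ, hgS, hgT⟩ := exists_isGuided hS₀ hS hT hfin₀ hSfin hTfin hδ
    (translationLength_pos_of_pos hS hS₀ hfin₀ ha) (translationLength_pos_of_pos hS hS₀ hfin₀ hb)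
    (pow_ne_zpow_of_ratio_ne hS hT hab)
    (pow_ne_zpow_of_ratio_ne hS hT (by intro h; apply hab; linarith))
  obtain ⟨M₁, hM₁⟩ := hgS.exists_wordLength_pump hS₀ hS hfin₀
  obtain ⟨M₂, hM₂⟩ := hgT.exists_wordLength_pump hS₀ hT hfin₀
  set M := max M₁ M₂
  set N := M.factorial
  set W := Submonoid.closure ({a ^ J, b ^ J} : Set Γ)
  have hpS := hM₁ M (le_max_left _ _)
  have hpT := hM₂ M (le_max_right _ _)
  have hA : a ^ J ∈ W := Submonoid.subset_closure (by simp)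
  have hB : b ^ J ∈ W := Submonoid.subset_closure (by simp)
  have hN : 0 < N := Nat.factorial_pos M
  have hint : ∀ X : Set Γ, (∀ u ∈ W, ∀ c ∈ W, ∀ v ∈ W, ∀ i ≥ M,
      (wordLength X (u * c ^ (i + N) * v) : ℝ) =
        wordLength X (u * c ^ i * v) + N * translationLength X c) →
      ∀ c ∈ W, ∃ z : ℤ, (z : ℝ) = N * translationLength X c := by
    intro X hX c hc
    have h1 := hX 1 (one_mem W) c hc 1 (one_mem W) M le_rfl
    refine ⟨wordLength X (1 * c ^ (M + N) * 1) - wordLength X (1 * c ^ M * 1), ?_⟩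
    push_cast; linarith
  have hU := mul_mem (pow_mem hA M) (pow_mem hB M)
  have hfamS := translationLength_family hS hpS hA hB
  have hfamT := translationLength_family hT hpT hA hB
  obtain ⟨x₁, hx₁⟩ := hint S hpS _ hA
  obtain ⟨y₁, hy₁⟩ := hint S hpS _ hB
  obtain ⟨μ₁, hμ₁⟩ := hint S hpS _ hU
  obtain ⟨x₂, hx₂⟩ := hint T hpT _ hA
  obtain ⟨y₂, hy₂⟩ := hint T hpT _ hB
  obtain ⟨μ₂, hμ₂⟩ := hint T hpT _ hU
  refine ⟨fun k s t => (a ^ J) ^ (M + s * N) * (b ^ J) ^ (M + t * N) *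
    ((a ^ J) ^ M * (b ^ J) ^ M) ^ k, N, N * N * J, N * x₁, N * x₂, N * y₁, N * y₂, μ₁, μ₂, hN,
    by positivity, ?_, ?_, ?_, ?_, fun k s t => ?_, fun k s t => ?_, fun k => ?_⟩
  · push_cast; rw [hx₁, translationLength_pow hS]; ring
  · push_cast; rw [hx₂, translationLength_pow hT]; ring
  · push_cast; rw [hy₁, translationLength_pow hS]; ring
  · push_cast; rw [hy₂, translationLength_pow hT]; ring
  · push_cast; rw [hfamS, hμ₁, hx₁, hy₁]; ring
  · push_cast; rw [hfamT, hμ₂, hx₂, hy₂]; ring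
  · set A := a ^ J
    set B := b ^ J
    set U := A ^ M * B ^ M
    refine ⟨(M + N) * (wordLength S A + wordLength S B) + k * wordLength S U + 1, by positivity,
      fun s t => ?_⟩
    have h1 := wordLength_mul_le hS (A ^ (M + s * N) * B ^ (M + t * N)) (U ^ k)
    have h2 := wordLength_mul_le hS (A ^ (M + s * N)) (B ^ (M + t * N))
    have h3 := wordLength_pow_le hS A (M + s * N)
    have h4 := wordLength_pow_le hS B (M + t * N)
    have h5 := wordLength_pow_le hS U k
    have h6 : (wordLength S (A ^ (M + s * N) * B ^ (M + t * N) * U ^ k) : ℝ) ≤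
        (M + s * N) * wordLength S A + (M + t * N) * wordLength S B + k * wordLength S U := by
      exact_mod_cast h1.trans (add_le_add (h2.trans (add_le_add h3 h4)) h5)
    refine h6.trans ?_
    have h7 : (M : ℝ) + s * N ≤ (M + N) * (1 + s + t) := by
      have : (0 : ℝ) ≤ M * (s + t) + N * (1 + t) := by positivity
      linarith
    have h8 : (M : ℝ) + t * N ≤ (M + N) * (1 + s + t) := by
      have : (0 : ℝ) ≤ M * (s + t) + N * (1 + s) := by positivity
      linarith
    have h9 : (k * wordLength S U : ℝ) ≤ k * wordLength S U * (1 + s + t) := by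
      have : (0 : ℝ) ≤ k * wordLength S U * (s + t) := by positivity
      linarith
    have h10 := mul_le_mul_of_nonneg_right h7 (Nat.cast_nonneg (α := ℝ) (wordLength S A))
    have h11 := mul_le_mul_of_nonneg_right h8 (Nat.cast_nonneg (α := ℝ) (wordLength S B))
    have h12 : (0 : ℝ) ≤ 1 + s + t := by positivity
    linarith

/-- Cramer's rule for hitting the ray through `(q, p)` by vectors `(k + 1) μ + s α + t β` with
natural coefficients. Taking `k + 1` to be the determinant `D` of `α` and `β` makes `(k + 1) μ` an
integral combination of `α` and `β`; its coefficients are absorbed as soon as those of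
`j D (q, p)` are large. -/
theorem exists_nat_combination {α₁ α₂ β₁ β₂ : ℤ} (μ₁ μ₂ : ℤ) {ra rb : ℝ} (hα₁ : 0 < α₁)
    (hβ₁ : 0 < β₁) (hα₂ : (α₂ : ℝ) = ra * α₁) (hβ₂ : (β₂ : ℝ) = rb * β₁) (hra : 0 ≤ ra)
    (hrab : ra < rb) :
    ∃ (k : ℕ) (D : ℤ) (C m : ℝ), 0 < D ∧ 0 < C ∧ 0 < m ∧ ∀ p q j : ℤ, 0 < q → 0 < j →
      m ≤ j * (q * rb - p) → m ≤ j * (p - q * ra) → ∃ s t : ℕ,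
        (k + 1) * μ₁ + s * α₁ + t * β₁ = j * D * q ∧
        (k + 1) * μ₂ + s * α₂ + t * β₂ = j * D * p ∧ (1 + s + t : ℝ) ≤ C * (j * q) := by
  have hα₁r : (1 : ℝ) ≤ α₁ := by exact_mod_cast hα₁
  have hβ₁r : (1 : ℝ) ≤ β₁ := by exact_mod_cast hβ₁
  have hrb : 0 ≤ rb := hra.trans hrab.le
  have hα₂r : (0 : ℝ) ≤ α₂ := by rw [hα₂]; positivity
  have hβ₂r : (0 : ℝ) ≤ β₂ := by rw [hβ₂]; positivity
  have hD0 : 0 < α₁ * β₂ - α₂ * β₁ := by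
    have : (0 : ℝ) < α₁ * β₂ - α₂ * β₁ := by
      rw [hα₂, hβ₂]
      have h1 : 0 < rb - ra := by linarith
      have h2 : 0 < (rb - ra) * (α₁ * β₁ : ℝ) := by positivity
      linarith
    exact_mod_cast this
  obtain ⟨D, hD⟩ : ∃ D : ℤ, D = α₁ * β₂ - α₂ * β₁ := ⟨_, rfl⟩
  obtain ⟨s₀, hs₀⟩ : ∃ s₀ : ℤ, s₀ = μ₁ * β₂ - μ₂ * β₁ := ⟨_, rfl⟩
  obtain ⟨t₀, ht₀⟩ : ∃ t₀ : ℤ, t₀ = α₁ * μ₂ - α₂ * μ₁ := ⟨_, rfl⟩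
  rw [← hD] at hD0
  obtain ⟨k, hk⟩ : ∃ k : ℕ, (k : ℤ) + 1 = D := ⟨(D - 1).toNat, by omega⟩
  refine ⟨k, D, 1 + β₂ + |(s₀ : ℝ)| + α₁ * rb + |(t₀ : ℝ)|, max 1 (max (s₀ : ℝ) t₀), hD0,
    by positivity, by positivity, fun p q j hq hj hsm htm => ?_⟩
  have hq' : (0 : ℝ) < q := by exact_mod_cast hq
  have hj' : (0 : ℝ) < j := by exact_mod_cast hj
  have hm1 : (1 : ℝ) ≤ max 1 (max (s₀ : ℝ) t₀) := le_max_left _ _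
  have hms : (s₀ : ℝ) ≤ j * (q * rb - p) :=
    ((le_max_left _ _).trans (le_max_right _ _)).trans hsm
  have hmt : (t₀ : ℝ) ≤ j * (p - q * ra) :=
    ((le_max_right _ _).trans (le_max_right _ _)).trans htm
  have hsp : 0 < (q * rb - p : ℝ) := pos_of_mul_pos_right (by linarith) hj'.le
  have htp : 0 < (p - q * ra : ℝ) := pos_of_mul_pos_right (by linarith) hj'.le
  have hs : s₀ ≤ j * (q * β₂ - p * β₁) := by
    have h1 : (s₀ : ℝ) ≤ j * (q * β₂ - p * β₁) := by
      rw [hβ₂]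
      have h2 : (j * (q * rb - p) : ℝ) * 1 ≤ j * (q * rb - p) * β₁ :=
        mul_le_mul_of_nonneg_left hβ₁r (by positivity)
      linarith
    exact_mod_cast h1
  have ht : t₀ ≤ j * (α₁ * p - α₂ * q) := by
    have h1 : (t₀ : ℝ) ≤ j * (α₁ * p - α₂ * q) := by
      rw [hα₂]
      have h2 : (j * (p - q * ra) : ℝ) * 1 ≤ j * (p - q * ra) * α₁ :=
        mul_le_mul_of_nonneg_left hα₁r (by positivity)
      linarith
    exact_mod_cast h1
  have hp0 : (0 : ℝ) ≤ p := by
    have h2 : 0 ≤ q * ra := by positivity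
    linarith
  obtain ⟨s, hs'⟩ := Int.eq_ofNat_of_zero_le (sub_nonneg.2 hs)
  obtain ⟨t, ht'⟩ := Int.eq_ofNat_of_zero_le (sub_nonneg.2 ht)
  refine ⟨s, t, ?_, ?_, ?_⟩
  · rw [← hs', ← ht', hk, hD, hs₀, ht₀]; ring
  · rw [← hs', ← ht', hk, hD, hs₀, ht₀]; ring
  · have hsr : (s : ℝ) = j * (q * β₂ - p * β₁) - s₀ := by exact_mod_cast hs'.symm
    have htr : (t : ℝ) = j * (α₁ * p - α₂ * q) - t₀ := by exact_mod_cast ht'.symm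
    have hjq : (1 : ℝ) ≤ j * q := by
      have : 1 ≤ j * q := Int.add_one_le_iff.2 (mul_pos hj hq)
      exact_mod_cast this
    have b1 : (s : ℝ) ≤ (β₂ + |(s₀ : ℝ)|) * (j * q) := by
      have h1 : (0 : ℝ) ≤ j * (p * β₁) := by positivity
      have h2 := neg_abs_le (s₀ : ℝ)
      have h3 : |(s₀ : ℝ)| * 1 ≤ |(s₀ : ℝ)| * (j * q) :=
        mul_le_mul_of_nonneg_left hjq (abs_nonneg _)
      rw [hsr]; linarith
    have b2 : (t : ℝ) ≤ (α₁ * rb + |(t₀ : ℝ)|) * (j * q) := by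
      have h1 : (0 : ℝ) ≤ j * (α₂ * q) := by positivity
      have h2 := neg_abs_le (t₀ : ℝ)
      have h3 : |(t₀ : ℝ)| * 1 ≤ |(t₀ : ℝ)| * (j * q) :=
        mul_le_mul_of_nonneg_left hjq (abs_nonneg _)
      have h4 : (j * α₁ : ℝ) * p ≤ j * α₁ * (q * rb) :=
        mul_le_mul_of_nonneg_left (by linarith) (by positivity)
      rw [htr]; linarith
    linarith

/-- Every rational `p / q` strictly between the ratios of `a` and `b` is the ratio of an element of
length `O(q)`; the auxiliary multiplier `j` makes room for fractions with a small denominator. -/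
theorem exists_translationLength_ratio_eq {S₀ S T : Set Γ} (hS₀ : Subgroup.closure S₀ = ⊤)
    (hS : Subgroup.closure S = ⊤) (hT : Subgroup.closure T = ⊤) (hfin₀ : S₀.Finite)
    (hSfin : S.Finite) (hTfin : T.Finite) {δ : ℝ} (hδ : IsHyperbolicDist (realDist S₀) δ)
    {a b : Γ} (ha : 0 < translationLength S a) (hb : 0 < translationLength S b)
    (hab : translationLength T a / translationLength S a <
      translationLength T b / translationLength S b) :
    ∃ C m : ℝ, 0 < C ∧ 0 < m ∧ ∀ p q j : ℤ, 0 < q → 0 < j →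
      m ≤ j * (q * (translationLength T b / translationLength S b) - p) →
      m ≤ j * (p - q * (translationLength T a / translationLength S a)) →
      ∃ g : Γ, 0 < translationLength S g ∧
        translationLength T g / translationLength S g = p / q ∧
        (wordLength S g : ℝ) ≤ C * (j * q) := by
  have hne : translationLength S a * translationLength T b ≠
      translationLength T a * translationLength S b := by
    rw [div_lt_div_iff₀ ha hb] at hab
    intro h
    linarith
  obtain ⟨g, N, P, α₁, α₂, β₁, β₂, μ₁, μ₂, hN, hP, hα₁, hα₂, hβ₁, hβ₂, hgS, hgT, hlen⟩ :=
    exists_affine_family hS₀ hS hT hfin₀ hSfin hTfin hδ ha hb hne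
  have hα₁0 : (0 : ℝ) < α₁ := by rw [hα₁]; positivity
  have hβ₁0 : (0 : ℝ) < β₁ := by rw [hβ₁]; positivity
  obtain ⟨k, D, C, m, hD, hC, hm, hcomb⟩ := exists_nat_combination μ₁ μ₂
    (by exact_mod_cast hα₁0) (by exact_mod_cast hβ₁0)
    (show (α₂ : ℝ) = translationLength T a / translationLength S a * α₁ by
      rw [hα₁, hα₂]; field_simp)
    (show (β₂ : ℝ) = translationLength T b / translationLength S b * β₁ by
      rw [hβ₁, hβ₂]; field_simp)
    (div_nonneg (translationLength_nonneg hT _) ha.le) hab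
  obtain ⟨L, hL, hlen⟩ := hlen k
  refine ⟨L * C, m, by positivity, hm, fun p q j hq hj h1 h2 => ?_⟩
  obtain ⟨s, t, h3, h4, h5⟩ := hcomb p q j hq hj h1 h2
  have hS' := hgS k s t
  have hT' := hgT k s t
  rw [h3] at hS'
  rw [h4] at hT'
  push_cast at hS' hT'
  have hN' : (0 : ℝ) < N := by exact_mod_cast hN
  have hD' : (0 : ℝ) < D := by exact_mod_cast hD
  have hq' : (0 : ℝ) < q := by exact_mod_cast hq
  have hj' : (0 : ℝ) < j := by exact_mod_cast hj
  refine ⟨g k s t, ?_, ?_, ?_⟩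
  · have : (0 : ℝ) < N * translationLength S (g k s t) := by rw [hS']; positivity
    exact pos_of_mul_pos_right this hN'.le
  · rw [← mul_div_mul_left _ _ hN'.ne', hS', hT']
    field_simp
  · refine (hlen s t).trans ?_
    rw [mul_assoc]
    exact mul_le_mul_of_nonneg_left h5 hL.le

/-! ### Diophantine approximation -/

/-- There are infinitely many fractions approximating an irrational number `η` to within the square
of their denominators, even if the denominators are required to be large. -/
theorem infinite_rat_abs_sub_lt_of_le_den {η : ℝ} (hη : Irrational η) (D : ℕ) :
    {r : ℚ | |η - r| < 1 / (r.den : ℝ) ^ 2 ∧ D ≤ r.den}.Infinite := by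
  have hfin : {r : ℚ | |η - r| < 1 / (r.den : ℝ) ^ 2 ∧ r.den < D}.Finite := by
    obtain ⟨B, hB⟩ := exists_nat_ge (|η| + 1)
    refine (((Set.finite_Icc (-(B * D : ℤ)) (B * D)).prod (Set.finite_Iio D)).preimage
      (f := fun r : ℚ => (r.num, r.den)) ?_).subset ?_
    · intro r _ r' _ h
      rw [Prod.mk.injEq] at h
      exact Rat.ext h.1 h.2
    · rintro r ⟨hr, hD⟩
      have hden : (1 : ℝ) ≤ r.den := by exact_mod_cast r.pos
      have h1 : |η - r| < 1 := hr.trans_le (by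
        rw [div_le_one (by positivity)]; exact one_le_pow₀ hden)
      have h2 : |(r : ℝ)| ≤ B := by
        have := abs_sub_abs_le_abs_sub (r : ℝ) η
        rw [abs_sub_comm] at this
        linarith
      have h3 : (r.num : ℝ) = r * r.den := by exact_mod_cast (Rat.mul_den_eq_num r).symm
      have h4 : |(r.num : ℝ)| ≤ B * D := by
        rw [h3, abs_mul, Nat.abs_cast]
        have : (r.den : ℝ) ≤ D := by exact_mod_cast hD.le
        exact mul_le_mul h2 this (by positivity) (by positivity)
      rw [abs_le] at h4
      refine ⟨⟨?_, ?_⟩, hD⟩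
      · exact_mod_cast h4.1
      · exact_mod_cast h4.2
  refine ((Real.infinite_rat_abs_sub_lt_one_div_den_sq_of_irrational hη).sdiff hfin).mono ?_
  rintro r ⟨h1, h2⟩
  exact ⟨h1, by by_contra h; exact h2 ⟨h1, by omega⟩⟩

/-- An element whose ratio is exactly `η` gives a sequence of such elements. -/
theorem exists_seq_of_ratio_eq {S T : Set Γ} (hS : Subgroup.closure S = ⊤)
    (hT : Subgroup.closure T = ⊤) {g : Γ} {η C : ℝ} (hC : 0 ≤ C) (hg : 0 < translationLength S g)
    (h : translationLength T g / translationLength S g = η) :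
    ∃ f : ℕ → Γ, Function.Injective f ∧ ∀ n : ℕ, 0 < translationLength S (f n) ∧
      |translationLength T (f n) / translationLength S (f n) - η| ≤
        C / (wordLength S (f n) : ℝ) ^ 2 := by
  refine ⟨fun n => g ^ (n + 1), fun m n hmn => ?_, fun n => ⟨?_, ?_⟩⟩
  · have h1 := congrArg (translationLength S) hmn
    simp only [translationLength_pow hS] at h1
    have h2 := mul_right_cancel₀ hg.ne' h1
    have : m + 1 = n + 1 := by exact_mod_cast h2
    omega
  · rw [translationLength_pow hS]; positivity
  · rw [translationLength_pow hS, translationLength_pow hT,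
      mul_div_mul_left _ _ (by positivity), h, sub_self, abs_zero]
    positivity

theorem IsNonElementary.infinite (h : IsNonElementary Γ) : Infinite Γ := by
  by_contra hfin
  rw [not_infinite_iff_finite] at hfin
  exact h ⟨⊥, inferInstance, inferInstance⟩

end WordMetric

open WordMetric in
theorem mainTheorem7 {Γ : Type*} [Group Γ]
    (hΓ : WordMetric.IsHyperbolicGroup Γ) (hne : WordMetric.IsNonElementary Γ)
    (S T : Set Γ) (hSfin : S.Finite) (hTfin : T.Finite)
    (hS : Subgroup.closure S = ⊤) (hT : Subgroup.closure T = ⊤) :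
    (∃ C : ℝ, 0 < C ∧
      ∀ η ∈ Set.Icc (WordMetric.dilation S T)⁻¹ (WordMetric.dilation T S),
        ∃ g : ℕ → Γ, Function.Injective g ∧ ∀ n : ℕ,
          0 < WordMetric.translationLength S (g n) ∧
          |WordMetric.translationLength T (g n) / WordMetric.translationLength S (g n) - η| ≤
            C / (WordMetric.wordLength S (g n) : ℝ) ^ 2) ∧
    (∀ q : ℚ,
      (q : ℝ) ∈ Set.Icc (WordMetric.dilation S T)⁻¹ (WordMetric.dilation T S) →
        ∃ g : Γ, 0 < WordMetric.translationLength S g ∧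
          WordMetric.translationLength T g / WordMetric.translationLength S g = (q : ℝ)) := by
  have := hne.infinite
  obtain ⟨S₀, hfin₀, hS₀, δ₀, hδ₀⟩ := hΓ
  have hδ := hδ₀.isHyperbolicDist hS₀
  obtain ⟨a, haT, hamax⟩ :=
    exists_forall_translationLength_mul_le hS₀ hT hS hfin₀ hTfin hSfin hδ
  obtain ⟨b, hb, hbmax⟩ :=
    exists_forall_translationLength_mul_le hS₀ hS hT hfin₀ hSfin hTfin hδ
  have ha := translationLength_pos_of_pos hT hS hSfin haT
  rw [dilation_eq_of_forall hT hS haT hamax, dilation_eq_of_forall hS hT hb hbmax, inv_div]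
  set ra := translationLength T a / translationLength S a with hra
  set rb := translationLength T b / translationLength S b with hrb
  rcases lt_or_ge ra rb with hlt | hge
  swap
  · -- The interval contains at most one point, the ratio of `a`.
    refine ⟨⟨1, one_pos, fun η hη => ?_⟩, fun q hq => ⟨a, ha, ?_⟩⟩
    · exact exists_seq_of_ratio_eq hS hT zero_le_one ha
        (le_antisymm hη.1 (hη.2.trans hge))
    · exact le_antisymm hq.1 (hq.2.trans hge)
  obtain ⟨C, m, hC, hm, hex⟩ := exists_translationLength_ratio_eq hS₀ hS hT hfin₀ hSfin hTfin hδ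
    ha hb hlt
  have hrat : ∀ q : ℚ, (q : ℝ) ∈ Set.Icc ra rb → ∃ g : Γ, 0 < translationLength S g ∧
      translationLength T g / translationLength S g = (q : ℝ) := by
    rintro q ⟨h1, h2⟩
    rcases h1.eq_or_lt with h1 | h1
    · exact ⟨a, ha, h1⟩
    rcases h2.eq_or_lt with h2 | h2
    · exact ⟨b, hb, h2.symm⟩
    have hden : (0 : ℝ) < q.den := by exact_mod_cast q.pos
    have hnum : (q.num : ℝ) = q * q.den := by exact_mod_cast (Rat.mul_den_eq_num q).symm
    have e1 : 0 < (q.den : ℝ) * (rb - q) := mul_pos hden (by linarith)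
    have e2 : 0 < (q.den : ℝ) * (q - ra) := mul_pos hden (by linarith)
    obtain ⟨j, hj⟩ := exists_nat_ge (max 1 (max (m / (q.den * (rb - q))) (m / (q.den * (q - ra)))))
    have hj1 : (1 : ℝ) ≤ j := (le_max_left _ _).trans hj
    have hj2 := ((le_max_left _ _).trans (le_max_right _ _)).trans hj
    have hj3 := ((le_max_right _ _).trans (le_max_right _ _)).trans hj
    rw [div_le_iff₀ e1] at hj2
    rw [div_le_iff₀ e2] at hj3
    obtain ⟨g, hg, hgr, -⟩ := hex q.num q.den j (by exact_mod_cast q.pos)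
      (by exact_mod_cast hj1) (by push_cast; rw [hnum]; linarith)
      (by push_cast; rw [hnum]; linarith)
    refine ⟨g, hg, hgr.trans ?_⟩
    rw [hnum]; push_cast; field_simp
  refine ⟨⟨C ^ 2, by positivity, fun η hη => ?_⟩, hrat⟩
  by_cases hirr : Irrational η
  swap
  · obtain ⟨q, rfl⟩ : ∃ q : ℚ, (q : ℝ) = η := by simpa [Irrational] using hirr
    obtain ⟨g, hg, hgr⟩ := hrat q hη
    exact exists_seq_of_ratio_eq hS hT (by positivity) hg hgr
  rcases hη.1.eq_or_lt with h1 | h1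
  · exact exists_seq_of_ratio_eq hS hT (by positivity) ha h1
  rcases hη.2.eq_or_lt with h2 | h2
  · exact exists_seq_of_ratio_eq hS hT (by positivity) hb h2.symm
  -- Good approximations with large denominators stay away from the ends of the interval.
  obtain ⟨ε, hε, hε1, hε2⟩ : ∃ ε : ℝ, 0 < ε ∧ 2 * ε ≤ η - ra ∧ 2 * ε ≤ rb - η :=
    ⟨min (η - ra) (rb - η) / 2, by have := lt_min (sub_pos.2 h1) (sub_pos.2 h2); linarith,
      by linarith [min_le_left (η - ra) (rb - η)], by linarith [min_le_right (η - ra) (rb - η)]⟩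
  obtain ⟨D, hD⟩ := exists_nat_ge (max (1 / ε) (m / ε))
  have hD1 := (le_max_left _ _).trans hD
  have hD2 := (le_max_right _ _).trans hD
  rw [div_le_iff₀ hε] at hD1 hD2
  have hinf := infinite_rat_abs_sub_lt_of_le_den hirr D
  have hgood : ∀ r ∈ {r : ℚ | |η - r| < 1 / (r.den : ℝ) ^ 2 ∧ D ≤ r.den}, ∃ g : Γ,
      0 < translationLength S g ∧ translationLength T g / translationLength S g = (r : ℝ) ∧
      (wordLength S g : ℝ) ≤ C * r.den := by
    rintro r ⟨hr, hrD⟩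
    have hden : (1 : ℝ) ≤ r.den := by exact_mod_cast r.pos
    have hDr : (D : ℝ) ≤ r.den := by exact_mod_cast hrD
    have hnum : (r.num : ℝ) = r * r.den := by exact_mod_cast (Rat.mul_den_eq_num r).symm
    have e0 : m ≤ r.den * ε := hD2.trans (mul_le_mul_of_nonneg_right hDr hε.le)
    have e1 : 1 / (r.den : ℝ) ^ 2 ≤ ε := by
      rw [div_le_iff₀ (by positivity)]
      nlinarith
    rw [abs_lt] at hr
    have e2 : (r.den : ℝ) * ε ≤ r.den * (rb - r) :=
      mul_le_mul_of_nonneg_left (by linarith) (by linarith)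
    have e3 : (r.den : ℝ) * ε ≤ r.den * (r - ra) :=
      mul_le_mul_of_nonneg_left (by linarith) (by linarith)
    obtain ⟨g, hg, hgr, hgl⟩ := hex r.num r.den 1 (by exact_mod_cast r.pos) one_pos
      (by push_cast; rw [hnum]; linarith) (by push_cast; rw [hnum]; linarith)
    refine ⟨g, hg, hgr.trans ?_, by simpa using hgl⟩
    rw [hnum]; push_cast; field_simp
  choose! G hG0 hGr hGl using hgood
  set e := hinf.natEmbedding
  refine ⟨fun n => G (e n), fun i j hij => ?_, fun n => ⟨hG0 _ (e n).2, ?_⟩⟩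
  · have h3 := hGr _ (e i).2
    rw [show G (e i) = G (e j) from hij, hGr _ (e j).2] at h3
    exact e.injective (Subtype.ext (by exact_mod_cast h3.symm))
  · have hr := (e n).2.1
    have hpos : (0 : ℝ) < wordLength S (G (e n)) :=
      (hG0 _ (e n).2).trans_le (translationLength_le hS _)
    have hden : (0 : ℝ) < ((e n : ℚ).den : ℝ) := by exact_mod_cast (e n : ℚ).pos
    rw [hGr _ (e n).2, abs_sub_comm]
    refine hr.le.trans ?_
    rw [div_le_div_iff₀ (by positivity) (by positivity), one_mul, ← mul_pow]
    exact pow_le_pow_left₀ hpos.le (hGl _ (e n).2) 2
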